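/- **Setting.** A *regular vine* on a finite set $V_1$ with $n$ elements is a sequence of trees $\mathcal V=(V_k,E_k)_{k=1}^{n-1}$ such that $V_k=E_{k-1}$ for $k\ge 2$ (edges being two-element sets of vertices) and, for $k\ge2$, any two vertices $a,b\in V_k$ joined by an edge of $E_k$ satisfy $|a\cap b|=1$ (proximity condition). The complete union $\mathcal U_v\subseteq V_1$ of a vertex or edge $v$ is the set of elements of $V_1$ occurring in its iterated construction ($\mathcal U_i=\{i\}$ for $i\in V_1$). An edge $e$ connecting $v_1$ and $v_2$ has conditioning set $D_e=\mathcal U_{v_1}\cap\mathcal U_{v_2}$ and conditioned elements $a_e,b_e$, given by $\{a_e\}=\mathcal U_{v_1}\setminus D_e$, $\{b_e\}=\mathcal U_{v_2}\setminus D_e$. A (simplified) *vine copula model* $(\mathcal V,\mathcal C(\mathcal V))$ assigns to each edge $e$ a bivariate copula density $c_e=c_{a_e,b_e|D_e}$ on $[0,1]^2$, i.e. a nonnegative measurable function with $\int_0^1 c_e(s,v)\,ds=1=\int_0^1 c_e(u,t)\,dt$ for all $u,v\in[0,1]$ (every absolutely continuous bivariate copula has a density with this property); exchanging the roles of $a_e$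 and $b_e$ exchanges the arguments of $c_e$. The model is the law on $[0,1]^{V_1}$ with density $$c(\boldsymbol u)=\prod_{k=1}^{n-1}\prod_{e\in E_k}c_e\bigl(u_{a_e|D_e},u_{b_e|D_e}\bigr),$$ where $u_{i|\emptyset}=u_i$ and, recursively, if $e$ connects $v_1$ and $v_2$ with $a_e\in\mathcal U_{v_1}$, $D_e\neq\emptyset$, then $v_1$ is an edge $e'$ which, suitably oriented, has $a_{e'}=a_e$ and $D_{e'}=D_e\setminus\{b_{e'}\}$, and $$u_{a_e|D_e}=\int_0^{u_{a_{e'}|D_{e'}}}c_{e'}\bigl(s,u_{b_{e'}|D_{e'}}\bigr)\,ds ;$$ $u_{b_e|D_e}$ is obtained in the same way from $v_2$. Let $T,d\ge1$ and consider vines whose first vertex set consists of pairs (time, variable). For edges $e,e'$ and $\tau\in\mathbb Z$ write $e=e'+(\tau,0)$ if $a_e=a_{e'}+(\tau,0)$, $b_e=b_{e'}+(\tau,0)$ (for suitable orientations) and $D_e=D_{e'}+(\tau,0)$. * A choice $\mathcal C(\mathcal V)$ of pair-copulas is *translation invariant* if $c_e=c_{e'}$ (with arguments ordered accordingly) for all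 edges $e,e'$ of $\mathcal V$ for which there is $\tau\in\mathbb Z$ with $e=e'+(\tau,0)$. * A vine copula model on $\{1,\dots,T\}\times\{1,\dots,d\}$, that is, for $\boldsymbol U_1,\dots,\boldsymbol U_T\in[0,1]^d$, is *stationary* if $(\boldsymbol U_{t_1},\dots,\boldsymbol U_{t_m})$ and $(\boldsymbol U_{t_1+\tau},\dots,\boldsymbol U_{t_m+\tau})$ have the same law whenever $1\le t_1<\dots<t_m$, $\tau\ge1$ and $t_m+\tau\le T$. * The *restriction* $\mathcal V_{t,t+m}$ of a vine $\mathcal V=(V_k,E_k)_k$ on $\{1,\dots,T\}\times\{1,\dots,d\}$ is the sequence of graphs $(V_k',E_k')_k$ with $V_1'=\{t,\dots,t+m\}\times\{1,\dots,d\}$, $E_k'=E_k\cap\binom{V_k'}{2}$, $V_{k+1}'=E_k'$. It need not be a vine. * Let $\mathcal V$ be a sequence of graphs on $\{t,\dots,t+m\}\times\{1,\dots,d\}$ and $\mathcal V'$ one on $\{s,\dots,s+m\}\times\{1,\dots,d\}$. We write $\mathcal V\sim\mathcal V'$ (*$\mathcal V$ is a translation of $\mathcal V'$*) if both are vines and,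 for every $k=1,\dots,(m+1)d-1$, each edge $e\in E_k$ has an edge $e'\in E'_k$ with $e=e'+(t-s,0)$, and vice versa. **Theorem.** Let $T,d\ge1$ and let $\mathcal V$ be a regular vine on $\{1,\dots,T\}\times\{1,\dots,d\}$. The following are equivalent: (i) The vine copula model $(\mathcal V,\mathcal C(\mathcal V))$ is stationary for every translation invariant choice of $\mathcal C(\mathcal V)$. (ii) There are vines $\mathcal V^{(m)}$ on $\{1,\dots,m+1\}\times\{1,\dots,d\}$, $m=0,\dots,T-1$, such that $\mathcal V_{t,t+m}\sim\mathcal V^{(m)}$ for all $m=0,\dots,T-1$ and $1\le t\le T-m$. -/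

import Mathlib

open MeasureTheory

namespace SVine

/-! ### Nested edges and regular vines -/

/-- `Node α 0 = α`, and a node of level `k + 1` is an unordered pair of nodes of level `k`.
The vertices of the `(k + 1)`-st tree of a vine on a subset of `α` are nodes of level `k`;
its edges, which are the vertices of the next tree, are nodes of level `k + 1`. -/
@[reducible] def Node (α : Type) : ℕ → Type
  | 0 => α
  | k + 1 => Sym2 (Node α k)

/-- A sequence of graphs, each having the edges of its predecessor as vertices:
`V k` is the vertex set of the `(k + 1)`-st graph (counting from one) and `V (k + 1)` is
its edge set. -/
def GraphSeq (α : Type) : Type := (k : ℕ) → Set (Node α k)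

variable {α : Type}

/-- The vertex set of the graph with (zero-based) number `k`. -/
def GraphSeq.verts (V : GraphSeq α) (k : ℕ) : Set (Node α k) := V k

/-- The edge set of the graph with (zero-based) number `k`. -/
def GraphSeq.edges (V : GraphSeq α) (k : ℕ) : Set (Sym2 (Node α k)) := V (k + 1)

/-- The pair `(V, E)` is a tree: `E` consists of two-element subsets of `V`, and the graph
is connected and acyclic. -/
def IsTreeOn {β : Type} (V : Set β) (E : Set (Sym2 β)) : Prop :=
  (∀ e ∈ E, ¬ e.IsDiag ∧ ∀ v ∈ e, v ∈ V) ∧ ((SimpleGraph.fromEdgeSet E).induce V).IsTree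

/-- `V` is a regular vine on the finite set `S`, with `n = #S` elements: a sequence of `n - 1`
trees, the first one having vertex set `S`, that satisfies the proximity condition. -/
structure IsVine (S : Finset α) (V : GraphSeq α) : Prop where
  verts_zero : V.verts 0 = (S : Set α)
  isTree : ∀ k, k + 1 < S.card → IsTreeOn (V.verts k) (V.edges k)
  /-- there are no further trees -/
  edges_eq_empty : ∀ k, S.card ≤ k + 1 → V.edges k = ∅
  proximity : ∀ (k : ℕ) (a b : Sym2 (Node α k)), s(a, b) ∈ V.edges (k + 1) →
    ∃! v : Node α k, v ∈ a ∧ v ∈ b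

/-- The complete union of a node: the elements of `α` occurring in its iterated construction. -/
def completeUnion : (k : ℕ) → Node α k → Set α
  | 0, i => {i}
  | k + 1, e => {i | ∃ v : Node α k, v ∈ (e : Sym2 (Node α k)) ∧ i ∈ completeUnion k v}

/-- The conditioning set `D_e` of an edge `e = {x, y}`. -/
def condSet {k : ℕ} (x y : Node α k) : Set α := completeUnion k x ∩ completeUnion k y

/-- The component of the conditioned set of the edge `{x, y}` that belongs to its end `x`. -/
def condPart {k : ℕ} (x y : Node α k) : Set α := completeUnion k x \ condSet x y

/-- The edge `{x, y}`, oriented from `x` to `y`, has conditioned pair `(a, b)`. -/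
def HasCondPair {k : ℕ} (x y : Node α k) (a b : α) : Prop :=
  condPart x y = {a} ∧ condPart y x = {b}

/-! ### Pair-copulas and simplified vine copula models -/

/-- A density of a bivariate copula: nonnegative, with uniform margins. Only its values on
`[0, 1] × [0, 1]` matter. Every density of an absolutely continuous copula agrees almost
everywhere with one for which, as here, the two margins equal one everywhere. -/
structure PairCopula where
  density : ℝ → ℝ → ℝ
  measurable_density : Measurable (Function.uncurry density)
  nonneg : ∀ u ∈ Set.Icc (0 : ℝ) 1, ∀ v ∈ Set.Icc (0 : ℝ) 1, 0 ≤ density u v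
  integral_left : ∀ v ∈ Set.Icc (0 : ℝ) 1, ∫ u in (0 : ℝ)..1, density u v = 1
  integral_right : ∀ u ∈ Set.Icc (0 : ℝ) 1, ∫ v in (0 : ℝ)..1, density u v = 1

/-- An assignment of pair-copulas to oriented edges: `C k x y` is the pair-copula
`c_{a, b | D}` of the edge `{x, y}` with `a` on the side of `x` and `b` on the side of `y`. -/
def PairCopulas (α : Type) : Type := (k : ℕ) → Node α k → Node α k → PairCopula

/-- The two orientations of an edge of `V` carry the same copula, with exchanged arguments:
so `C` assigns one bivariate copula to each edge. -/
def PairCopulas.IsChoiceFor (C : PairCopulas α) (V : GraphSeq α) : Prop :=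
  ∀ (k : ℕ) (x y : Node α k), s(x, y) ∈ V.edges k →
    ∀ u v : ℝ, (C k y x).density v u = (C k x y).density u v

open Classical in
/-- For a node `e` and an element `a` of its conditioned set, the value `u_{a | D}` of the
conditional distribution function, where `D` consists of the other elements of the complete
union of `e`. It is `u_a` for a single vertex. If `e = {x, y}` has conditioned pair `(a, b)` and
conditioning set `D'`, it is the partial derivative in the second argument of the copula of `e`,
`∫ s in 0..u_{a | D'}, c_e(s, u_{b | D'})`. (The value `0` is never used in a vine.) -/
noncomputable def condValue (C : PairCopulas α) (u : α → ℝ) : (k : ℕ) → Node α k → α → ℝ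
  | 0, i, _ => u i
  | k + 1, e, a =>
    if h : ∃ p : Node α k × Node α k × α,
        (e : Sym2 (Node α k)) = s(p.1, p.2.1) ∧ HasCondPair p.1 p.2.1 a p.2.2 then
      ∫ s in (0 : ℝ)..(condValue C u k h.choose.1 a),
        (C k h.choose.1 h.choose.2.1).density s
          (condValue C u k h.choose.2.1 h.choose.2.2)
    else 0

open Classical in
/-- The factor `c_e(u_{a | D}, u_{b | D})` of an edge `e` with label `(a, b | D)`. Which of its
two orientations is used does not matter. (The value `1` in the last line is never used in a
vine.) -/
noncomputable def edgeFactor (C : PairCopulas α) (u : α → ℝ) (k : ℕ) (e : Sym2 (Node α k)) : ℝ :=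
  if h : ∃ p : Node α k × Node α k × α × α,
      e = s(p.1, p.2.1) ∧ HasCondPair p.1 p.2.1 p.2.2.1 p.2.2.2 then
    (C k h.choose.1 h.choose.2.1).density
      (condValue C u k h.choose.1 h.choose.2.2.1)
      (condValue C u k h.choose.2.1 h.choose.2.2.2)
  else 1

/-- The density of the simplified vine copula model: the product of all edge factors. -/
noncomputable def vineDensity (S : Finset α) (V : GraphSeq α) (C : PairCopulas α)
    (u : α → ℝ) : ℝ :=
  ∏ k ∈ Finset.range (S.card - 1), ∏ᶠ (e : Sym2 (Node α k)) (_ : e ∈ V.edges k), edgeFactor C u k e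

open Classical in
/-- A vector indexed by `S`, as a function on all of `α`. -/
noncomputable def extendZero {S : Finset α} (u : S → ℝ) (i : α) : ℝ :=
  if h : i ∈ S then u ⟨i, h⟩ else 0

/-- The law on `[0, 1] ^ S` of the vine copula model `(V, C)`. -/
noncomputable def vineLaw (S : Finset α) (V : GraphSeq α) (C : PairCopulas α) :
    Measure (S → ℝ) :=
  (volume.restrict (Set.Icc (0 : S → ℝ) 1)).withDensity
    fun u => ENNReal.ofReal (vineDensity S V C (extendZero u))

/-! ### Time series -/

/-- The index set `{s, …, t} × {1, …, d}`; `Fin d` plays the role of `{1, …, d}`. -/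
noncomputable def block (d : ℕ) (s t : ℤ) : Finset (ℤ × Fin d) := Finset.Icc s t ×ˢ Finset.univ

/-- The shift `v ↦ v + (τ, 0)` in time. -/
def shift {d : ℕ} (τ : ℤ) (v : ℤ × Fin d) : ℤ × Fin d := (v.1 + τ, v.2)

/-- The label of `{x, y}` is the label of `{x', y'}` shifted by `τ`, `x` corresponding to `x'`
and `y` to `y'`. -/
def IsShiftOriented {d : ℕ} (τ : ℤ) {k l : ℕ} (x y : Node (ℤ × Fin d) k)
    (x' y' : Node (ℤ × Fin d) l) : Prop :=
  condPart x y = shift τ '' condPart x' y' ∧ condPart y x = shift τ '' condPart y' x' ∧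
    condSet x y = shift τ '' condSet x' y'

/-- `e = e' + (τ, 0)`. -/
def IsShift {d : ℕ} (τ : ℤ) {k l : ℕ} (e : Sym2 (Node (ℤ × Fin d) k))
    (e' : Sym2 (Node (ℤ × Fin d) l)) : Prop :=
  ∃ x y x' y', e = s(x, y) ∧ e' = s(x', y') ∧ IsShiftOriented τ x y x' y'

/-- Translation invariance: edges of `V` which are shifts of each other have the same
pair-copula. -/
def TranslationInvariant {d : ℕ} (V : GraphSeq (ℤ × Fin d)) (C : PairCopulas (ℤ × Fin d)) : Prop :=
  ∀ (τ : ℤ) (k l : ℕ) (x y : Node (ℤ × Fin d) k) (x' y' : Node (ℤ × Fin d) l),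
    s(x, y) ∈ V.edges k → s(x', y') ∈ V.edges l → IsShiftOriented τ x y x' y' →
      C k x y = C l x' y'

/-- Strict stationarity of the series `U_1, …, U_T` of `d`-vectors with joint law `P`. -/
def IsStationary (T d : ℕ) (P : Measure (block d 1 T → ℝ)) : Prop :=
  ∀ (m : ℕ) (t : Fin m → ℤ) (τ : ℤ), StrictMono t → (∀ i, 1 ≤ t i) → 1 ≤ τ →
    (∀ i, t i + τ ≤ T) →
    P.map (fun u (i : Fin m) (j : Fin d) => extendZero u (t i, j)) =
      P.map (fun u (i : Fin m) (j : Fin d) => extendZero u (t i + τ, j))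

/-- The restriction of a sequence of graphs: keep the vertices in `S` of the first graph and, at
each level, the edges both of whose ends have been kept. -/
def GraphSeq.restrict (V : GraphSeq α) (S : Finset α) : GraphSeq α
  | 0 => (S : Set α)
  | k + 1 => {e : Sym2 (Node α k) | e ∈ V.edges k ∧ ∀ v ∈ e, v ∈ GraphSeq.restrict V S k}

/-- `V`, a vine on `{t, …, t + m} × {1, …, d}`, is a translation of `V'`, a vine on
`{s, …, s + m} × {1, …, d}`. -/
def IsTranslation {d : ℕ} (m : ℕ) (t s : ℤ) (V V' : GraphSeq (ℤ × Fin d)) : Prop :=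
  IsVine (block d t (t + m)) V ∧ IsVine (block d s (s + m)) V' ∧
    ∀ k : ℕ, (∀ e ∈ V.edges k, ∃ e' ∈ V'.edges k, IsShift (t - s) e e') ∧
      (∀ e' ∈ V'.edges k, ∃ e ∈ V.edges k, IsShift (t - s) e e')

end SVine

namespace SVine

/-! ### Trees and forests -/

section Forest

variable {β : Type} {V : Set β} {E : Set (Sym2 β)}

/-! The bridge between the two conditions is `TranslationClosed`: whenever the conditioned pair of
an edge can be moved in time without leaving the range, the whole edge can be moved along inside the
vine. The proof runs (i) ⇒ `TranslationClosed` ⇒ (ii) ⇒ (i).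

Counting comes first. By proximity an edge splits at most one pair of elements. A vine on `n`
elements has `(n - 1) + … + 1 = n.choose 2` edges and every pair is split by some edge, so edges and
pairs correspond bijectively (`IsVine.exists_splits_inj`). Hence each edge has a conditioned pair,
and a node is determined by its level and its complete union.

(ii) ⇒ (i). The marginal law on the complete union of a node is the product of the factors of the
edges inside that union (`IsVine.lintegral_vineLaw_of_node`): elements outside are integrated out
one at a time, each step being a probability integral transform. By (ii) a block is the complete
union of a node, and shifting it matches the edges inside it, hence their copulas and factors. So
the marginals on shifted blocks agree (`HasTranslates.map_eq`).

(i) ⇒ `TranslationClosed`. For an edge with conditioned pair `(a, b)`, put the copula density `1 +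
(1 - 2u)(1 - 2v)` on its shifts and independence elsewhere. No conditioning is felt at the level of
these edges, so the joint density is the product of `1 + score (u (shift σ a)) * score (u (shift σ
b))` over the set `R` of shifts realised in the vine. The expected product of the scores of `a` and
`b` is positive because `0 ∈ R`; for the pair shifted by `τ ∉ R` it vanishes. Stationarity makes the
two equal, so every admissible `τ` is in `R`.

`TranslationClosed` ⇒ (ii). Sliding an edge to both ends of the time range shows that its complete
union lies between the times of its conditioned pair. So every pair in a block is split by an edge
inside the block, and the counting argument turns the restricted forests into trees
(`IsVine.restrict`). -/

lemma image_edgeSet_induce (hE : ∀ e ∈ E, ¬ e.IsDiag ∧ ∀ v ∈ e, v ∈ V) :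
    Sym2.map Subtype.val '' ((SimpleGraph.fromEdgeSet E).induce V).edgeSet = E := by
  ext e
  constructor
  · rintro ⟨f, hf, rfl⟩
    induction f using Sym2.ind with
    | _ x y =>
      rw [SimpleGraph.mem_edgeSet] at hf
      simp only [SimpleGraph.comap_adj, Function.Embedding.subtype_apply,
        SimpleGraph.fromEdgeSet_adj] at hf
      simpa using hf.1
  · intro he
    induction e using Sym2.ind with
    | _ x y =>
      obtain ⟨h1, h2⟩ := hE _ he
      refine ⟨s(⟨x, h2 x (by simp)⟩, ⟨y, h2 y (by simp)⟩), ?_, by simp⟩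
      rw [SimpleGraph.mem_edgeSet]
      simp only [SimpleGraph.comap_adj, Function.Embedding.subtype_apply,
        SimpleGraph.fromEdgeSet_adj]
      exact ⟨he, by simpa using h1⟩

lemma ncard_edgeSet_induce (hE : ∀ e ∈ E, ¬ e.IsDiag ∧ ∀ v ∈ e, v ∈ V) :
    ((SimpleGraph.fromEdgeSet E).induce V).edgeSet.ncard = E.ncard := by
  conv_rhs => rw [← image_edgeSet_induce hE]
  exact (Set.ncard_image_of_injective _ (Sym2.map.injective Subtype.val_injective)).symm

lemma IsTreeOn.ncard_add_one (h : IsTreeOn V E) (hV : V.Finite) : E.ncard + 1 = V.ncard := by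
  have : Finite V := hV
  have h1 := (SimpleGraph.isTree_iff_connected_and_card.1 h.2).2
  rwa [Nat.card_coe_set_eq, ncard_edgeSet_induce h.1, Nat.card_coe_set_eq] at h1

lemma IsTreeOn.exists_mem {v : β} (h : IsTreeOn V E) (hV : 2 ≤ V.ncard) (hv : v ∈ V) :
    ∃ w, s(v, w) ∈ E := by
  have hnt : Nontrivial V := by
    have : V.Nontrivial := (Set.one_lt_ncard_iff_nontrivial_and_finite.1 hV).1
    exact this.coe_sort
  obtain ⟨w, hw⟩ := h.2.1.preconnected.exists_adj_of_nontrivial ⟨v, hv⟩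
  exact ⟨w, (by simpa using hw : s(v, (w : β)) ∈ E ∧ _).1⟩

lemma exists_isTree_ge {γ : Type} [Nonempty γ] {G : SimpleGraph γ} (hG : G.IsAcyclic) :
    ∃ H, G ≤ H ∧ H.IsTree := by
  obtain ⟨H, h1, -, h3⟩ :=
    (SimpleGraph.connected_top (V := γ)).exists_isTree_le_of_le_of_isAcyclic le_top hG
  exact ⟨H, h1, h3⟩

lemma ncard_add_one_le_of_isAcyclic (hE : ∀ e ∈ E, ¬ e.IsDiag ∧ ∀ v ∈ e, v ∈ V)
    (h : ((SimpleGraph.fromEdgeSet E).induce V).IsAcyclic) (hV : V.Finite) (hne : V.Nonempty) :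
    E.ncard + 1 ≤ V.ncard := by
  have : Finite V := hV
  have : Nonempty V := hne.to_subtype
  obtain ⟨H, h1, h2⟩ := exists_isTree_ge h
  have h3 := (SimpleGraph.isTree_iff_connected_and_card.1 h2).2
  rw [Nat.card_coe_set_eq, Nat.card_coe_set_eq] at h3
  have h4 := Set.ncard_le_ncard (SimpleGraph.edgeSet_mono h1) (Set.toFinite _)
  rw [ncard_edgeSet_induce hE] at h4
  omega

/-- Extend the forest to a tree on `V`; the edge count leaves no room for an additional edge. -/
lemma isTreeOn_of_isAcyclic (hE : ∀ e ∈ E, ¬ e.IsDiag ∧ ∀ v ∈ e, v ∈ V)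
    (h : ((SimpleGraph.fromEdgeSet E).induce V).IsAcyclic) (hV : V.Finite)
    (hc : E.ncard + 1 = V.ncard) : IsTreeOn V E := by
  have : Finite V := hV
  have hne : V.Nonempty := Set.nonempty_of_ncard_ne_zero (by omega)
  have : Nonempty V := hne.to_subtype
  obtain ⟨H, h1, h2⟩ := exists_isTree_ge h
  have h3 := (SimpleGraph.isTree_iff_connected_and_card.1 h2).2
  rw [Nat.card_coe_set_eq, Nat.card_coe_set_eq] at h3
  have h4 : ((SimpleGraph.fromEdgeSet E).induce V).edgeSet = H.edgeSet := by
    refine Set.eq_of_subset_of_ncard_le (SimpleGraph.edgeSet_mono h1) ?_ (Set.toFinite _)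
    rw [ncard_edgeSet_induce hE]
    omega
  exact ⟨hE, by rwa [SimpleGraph.edgeSet_injective h4]⟩

end Forest

/-! ### Complete unions and conditioned pairs -/

section Structure

variable {α : Type}

@[simp] lemma completeUnion_zero (i : α) : completeUnion 0 i = {i} := rfl

lemma completeUnion_mk {k : ℕ} (x y : Node α k) :
    completeUnion (k + 1) s(x, y) = completeUnion k x ∪ completeUnion k y := by
  ext i
  simp only [completeUnion, Set.mem_ofPred_eq, Sym2.mem_iff, Set.mem_union]
  constructor
  · rintro ⟨v, rfl | rfl, h⟩ <;> simp [h]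
  · rintro (h | h)
    · exact ⟨x, .inl rfl, h⟩
    · exact ⟨y, .inr rfl, h⟩

lemma condSet_comm {k : ℕ} (x y : Node α k) : condSet x y = condSet y x := Set.inter_comm _ _

lemma condPart_eq {k : ℕ} (x y : Node α k) :
    condPart x y = completeUnion k x \ completeUnion k y := by
  simp [condPart, condSet]

lemma HasCondPair.symm {k : ℕ} {x y : Node α k} {a b : α} (h : HasCondPair x y a b) :
    HasCondPair y x b a := ⟨h.2, h.1⟩

lemma HasCondPair.left_mem {k : ℕ} {x y : Node α k} {a b : α} (h : HasCondPair x y a b) :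
    a ∈ completeUnion k x ∧ a ∉ completeUnion k y := by
  have : a ∈ condPart x y := by rw [h.1]; rfl
  rwa [condPart_eq] at this

lemma HasCondPair.right_mem {k : ℕ} {x y : Node α k} {a b : α} (h : HasCondPair x y a b) :
    b ∈ completeUnion k y ∧ b ∉ completeUnion k x := h.symm.left_mem

lemma HasCondPair.ne {k : ℕ} {x y : Node α k} {a b : α} (h : HasCondPair x y a b) : a ≠ b := by
  rintro rfl
  exact h.right_mem.2 h.left_mem.1

lemma HasCondPair.eq_left {k : ℕ} {x y : Node α k} {a b i : α} (h : HasCondPair x y a b)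
    (h1 : i ∈ completeUnion k x) (h2 : i ∉ completeUnion k y) : i = a := by
  have : i ∈ condPart x y := by rw [condPart_eq]; exact ⟨h1, h2⟩
  rw [h.1] at this
  exact this

lemma HasCondPair.unique {k : ℕ} {x y : Node α k} {a b a' b' : α} (h : HasCondPair x y a b)
    (h' : HasCondPair x y a' b') : a' = a ∧ b' = b :=
  ⟨h.eq_left h'.left_mem.1 h'.left_mem.2, h.symm.eq_left h'.right_mem.1 h'.right_mem.2⟩

lemma HasCondPair.completeUnion_eq {k : ℕ} {x y : Node α k} {a b : α}
    (h : HasCondPair x y a b) : completeUnion (k + 1) s(x, y) = insert a (completeUnion k y) := by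
  rw [completeUnion_mk]
  have h1 : completeUnion k x \ completeUnion k y = {a} := by rw [← condPart_eq, h.1]
  rw [← Set.sdiff_union_self, h1, Set.singleton_union]

end Structure

/-! ### Structure of regular vines -/

section Vine

variable {α : Type} {S : Finset α} {V : GraphSeq α}

lemma IsVine.edge (hV : IsVine S V) {k : ℕ} {e : Sym2 (Node α k)} (he : e ∈ V.edges k) :
    k + 1 < S.card ∧ ¬ e.IsDiag ∧ ∀ v ∈ e, v ∈ V.verts k := by
  have h : k + 1 < S.card := by
    by_contra h
    rw [hV.edges_eq_empty k (by omega)] at he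
    exact he
  exact ⟨h, (hV.isTree k h).1 e he⟩

lemma IsVine.left_mem (hV : IsVine S V) {k : ℕ} {x y : Node α k} (he : s(x, y) ∈ V.edges k) :
    x ∈ V.verts k := (hV.edge he).2.2 x (by simp)

lemma IsVine.right_mem (hV : IsVine S V) {k : ℕ} {x y : Node α k} (he : s(x, y) ∈ V.edges k) :
    y ∈ V.verts k := (hV.edge he).2.2 y (by simp)

lemma IsVine.completeUnion_subset (hV : IsVine S V) :
    ∀ {k : ℕ} {v : Node α k}, v ∈ V.verts k → completeUnion k v ⊆ S
  | 0, v, hv => by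
    rw [hV.verts_zero] at hv
    simpa using hv
  | k + 1, e, he => by
    induction e using Sym2.ind with
    | _ x y =>
      rw [completeUnion_mk]
      exact Set.union_subset (hV.completeUnion_subset (hV.left_mem he))
        (hV.completeUnion_subset (hV.right_mem he))

lemma IsVine.finite_verts (hV : IsVine S V) : ∀ k, (V.verts k).Finite
  | 0 => by rw [hV.verts_zero]; exact S.finite_toSet
  | k + 1 => by
    refine (((hV.finite_verts k).prod (hV.finite_verts k)).image fun p => s(p.1, p.2)).subset ?_
    intro e he
    induction e using Sym2.ind with
    | _ x y => exact ⟨(x, y), ⟨hV.left_mem he, hV.right_mem he⟩, rfl⟩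

lemma IsVine.ncard_verts (hV : IsVine S V) : ∀ {k : ℕ}, k < S.card →
    (V.verts k).ncard = S.card - k
  | 0, _ => by rw [hV.verts_zero, Set.ncard_coe_finset]; simp
  | k + 1, hk => by
    have h1 := (hV.isTree k hk).ncard_add_one (hV.finite_verts k)
    rw [hV.ncard_verts (by omega)] at h1
    change (V.edges k).ncard = _
    omega

lemma IsVine.exists_edge (hV : IsVine S V) {k : ℕ} (hk : k + 1 < S.card) {v : Node α k}
    (hv : v ∈ V.verts k) : ∃ w, s(v, w) ∈ V.edges k :=
  (hV.isTree k hk).exists_mem (by rw [hV.ncard_verts (by omega)]; omega) hv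

/-- By proximity adjacent nodes are `x = {z, p}` and `y = {z, q}`. What `x` has beyond `y` lies in
the complete union of `p` but not of `z`, and `{p, z}` is an edge one level down. -/
lemma IsVine.diff_subsingleton (hV : IsVine S V) : ∀ {k : ℕ} {x y : Node α k},
    s(x, y) ∈ V.edges k → (completeUnion k x \ completeUnion k y).Subsingleton
  | 0, x, y, _ => Set.subsingleton_singleton.anti Set.sdiff_subset
  | k + 1, x, y, he => by
    obtain ⟨z, ⟨hzx, hzy⟩, -⟩ := hV.proximity k x y he
    have hx := hV.left_mem he
    obtain ⟨p, rfl⟩ := Sym2.mem_iff_exists.1 hzx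
    obtain ⟨q, rfl⟩ := Sym2.mem_iff_exists.1 hzy
    have hx' : s(p, z) ∈ V.edges k := by rw [Sym2.eq_swap]; exact hx
    refine (hV.diff_subsingleton hx').anti ?_
    simp only [completeUnion_mk]
    rintro i ⟨h1 | h1, h2⟩
    · exact absurd (Or.inl h1) h2
    · exact ⟨h1, fun h => h2 (Or.inl h)⟩

lemma IsVine.exists_mem_completeUnion (hV : IsVine S V) {i : α} (hi : i ∈ S) :
    ∀ {k : ℕ}, k < S.card → ∃ v ∈ V.verts k, i ∈ completeUnion k v
  | 0, _ => ⟨i, by rw [hV.verts_zero]; exact hi, rfl⟩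
  | k + 1, hk => by
    obtain ⟨v, hv, hiv⟩ := hV.exists_mem_completeUnion hi (k := k) (by omega)
    obtain ⟨w, hw⟩ := hV.exists_edge hk hv
    exact ⟨s(v, w), hw, by rw [completeUnion_mk]; exact Or.inl hiv⟩

lemma IsVine.exists_top (hV : IsVine S V) {k : ℕ} (hk : S.card = k + 1) :
    ∃ v ∈ V.verts k, completeUnion k v = S := by
  have h1 := hV.ncard_verts (k := k) (by omega)
  obtain ⟨v, hv⟩ := Set.ncard_eq_one.1 (by omega : (V.verts k).ncard = 1)
  have hvm : v ∈ V.verts k := by rw [hv]; rfl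
  refine ⟨v, hvm, (hV.completeUnion_subset hvm).antisymm fun i hi => ?_⟩
  obtain ⟨w, hw, hiw⟩ := hV.exists_mem_completeUnion hi (k := k) (by omega)
  rw [hv] at hw
  obtain rfl : w = v := hw
  exact hiw

/-- An edge together with its level. -/
abbrev Edge (α : Type) := Σ k : ℕ, Sym2 (Node α k)

/-- The complete union of an edge. -/
def Edge.union (f : Edge α) : Set α := completeUnion (f.1 + 1) f.2

/-- `{i, j}` is split by the edge `f`. -/
def Splits (f : Edge α) (i j : α) : Prop :=
  ∃ x y, f.2 = s(x, y) ∧ i ∈ completeUnion f.1 x ∧ i ∉ completeUnion f.1 y ∧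
    j ∈ completeUnion f.1 y ∧ j ∉ completeUnion f.1 x

lemma splits_mk {k : ℕ} {e : Sym2 (Node α k)} {i j : α} : Splits ⟨k, e⟩ i j ↔
    ∃ x y, e = s(x, y) ∧ i ∈ completeUnion k x ∧ i ∉ completeUnion k y ∧
      j ∈ completeUnion k y ∧ j ∉ completeUnion k x := Iff.rfl

/-- Descend as long as one end still contains both elements; the edge where this stops separates
them. -/
lemma IsVine.exists_splits (hV : IsVine S V) {i j : α} (hij : i ≠ j) :
    ∀ {k : ℕ} {v : Node α k}, v ∈ V.verts k → i ∈ completeUnion k v → j ∈ completeUnion k v →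
      ∃ f : Edge α, f.2 ∈ V.edges f.1 ∧ Splits f i j ∧ f.union ⊆ completeUnion k v
  | 0, v, _, hi, hj => absurd ((show i = v from hi).trans (show j = v from hj).symm) hij
  | k + 1, e, he, hi, hj => by
    induction e using Sym2.ind with
    | _ x y =>
      have hcu := completeUnion_mk x y
      by_cases h1 : i ∈ completeUnion k x ∧ j ∈ completeUnion k x
      · obtain ⟨f, hf, hs, hu⟩ := hV.exists_splits hij (hV.left_mem he) h1.1 h1.2
        exact ⟨f, hf, hs, hu.trans (by rw [hcu]; exact Set.subset_union_left)⟩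
      by_cases h2 : i ∈ completeUnion k y ∧ j ∈ completeUnion k y
      · obtain ⟨f, hf, hs, hu⟩ := hV.exists_splits hij (hV.right_mem he) h2.1 h2.2
        exact ⟨f, hf, hs, hu.trans (by rw [hcu]; exact Set.subset_union_right)⟩
      refine ⟨⟨k, s(x, y)⟩, he, ?_, subset_rfl⟩
      rw [hcu] at hi hj
      simp only [Set.mem_union] at hi hj
      by_cases h3 : i ∈ completeUnion k x
      · exact ⟨x, y, rfl, h3, by tauto, by tauto, by tauto⟩
      · exact ⟨y, x, Sym2.eq_swap, by tauto, by tauto, by tauto, by tauto⟩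

/-- Both one-sided differences of an edge have at most one element, which leaves at most one
unordered pair to split. -/
lemma IsVine.splits_unique (hV : IsVine S V) {f : Edge α} (hf : f.2 ∈ V.edges f.1)
    {i j i' j' : α} (h : Splits f i j) (h' : Splits f i' j') :
    (i' = i ∧ j' = j) ∨ (i' = j ∧ j' = i) := by
  obtain ⟨k, e⟩ := f
  change e ∈ V.edges k at hf
  obtain ⟨x, y, hxy, h1, h2, h3, h4⟩ := splits_mk.1 h
  obtain ⟨x', y', hxy', h1', h2', h3', h4'⟩ := splits_mk.1 h'
  obtain rfl : e = s(x, y) := hxy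
  have hx := hV.diff_subsingleton hf
  have hy := hV.diff_subsingleton (x := y) (y := x) (by rw [Sym2.eq_swap]; exact hf)
  rcases Sym2.eq_iff.1 hxy' with ⟨rfl, rfl⟩ | ⟨rfl, rfl⟩
  · exact .inl ⟨hx ⟨h1', h2'⟩ ⟨h1, h2⟩, hy ⟨h3', h4'⟩ ⟨h3, h4⟩⟩
  · exact .inr ⟨hy ⟨h1', h2'⟩ ⟨h3, h4⟩, hx ⟨h3', h4'⟩ ⟨h1, h2⟩⟩

open Classical in
/-- The finite set of all edges of all levels. -/
noncomputable def IsVine.edgeFinset (hV : IsVine S V) : Finset (Edge α) :=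
  (Finset.range (S.card - 1)).sigma fun k => (hV.finite_verts (k + 1)).toFinset

lemma IsVine.mem_edgeFinset (hV : IsVine S V) {f : Edge α} :
    f ∈ hV.edgeFinset ↔ f.2 ∈ V.edges f.1 := by
  rw [IsVine.edgeFinset, Finset.mem_sigma, Set.Finite.mem_toFinset, Finset.mem_range]
  refine ⟨fun h => h.2, fun h => ⟨?_, h⟩⟩
  have := (hV.edge h).1
  omega

lemma sum_range_sub_choose (n : ℕ) :
    ∑ k ∈ Finset.range (n - 1), (n - (k + 1)) = n.choose 2 := by
  cases n with
  | zero => simp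
  | succ m =>
    have h := Finset.sum_range_reflect (fun j => j + 1) m
    have h2 : ∀ m, ∑ j ∈ Finset.range m, (j + 1) = (m + 1).choose 2 := by
      intro m
      induction m with
      | zero => simp
      | succ m ih => rw [Finset.sum_range_succ, ih, Nat.choose_succ_succ' (m + 1) 1]; simp; ring
    rw [Nat.add_sub_cancel, ← h2, ← h]
    refine Finset.sum_congr rfl fun k hk => ?_
    have := Finset.mem_range.1 hk
    omega

lemma IsVine.card_edgeFinset (hV : IsVine S V) : hV.edgeFinset.card = S.card.choose 2 := by
  rw [IsVine.edgeFinset, Finset.card_sigma, ← sum_range_sub_choose]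
  refine Finset.sum_congr rfl fun k hk => ?_
  have := Finset.mem_range.1 hk
  rw [← Set.ncard_eq_toFinset_card _ (hV.finite_verts (k + 1)), hV.ncard_verts (by omega)]

/-- Every pair of elements is split by some edge, so counting shows that splitting is a
bijection between edges and pairs. -/
lemma IsVine.exists_splits_of_mem (hV : IsVine S V) {i j : α} (hij : i ≠ j) (hi : i ∈ S)
    (hj : j ∈ S) : ∃ f : Edge α, f.2 ∈ V.edges f.1 ∧ Splits f i j := by
  have hc : S.card ≠ 0 := Finset.card_ne_zero_of_mem hi
  obtain ⟨v, hv, hu⟩ := hV.exists_top (k := S.card - 1) (by omega)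
  obtain ⟨f, hf, hs, -⟩ := hV.exists_splits hij hv (by rw [hu]; exact hi) (by rw [hu]; exact hj)
  exact ⟨f, hf, hs⟩

open Classical in
-- Choose for each pair an edge `φ` splitting it. No edge splits two pairs, so `φ` is injective from
-- pairs to edges; both sets have `S.card.choose 2` elements, so `φ` is onto. Thus every edge splits
-- a pair, and two edges splitting the same pair are equal.
lemma IsVine.exists_splits_inj (hV : IsVine S V) {f : Edge α} (hf : f.2 ∈ V.edges f.1) :
    (∃ i j, i ≠ j ∧ Splits f i j) ∧ ∀ i j, Splits f i j → ∀ g : Edge α, g.2 ∈ V.edges g.1 →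
      Splits g i j → g = f := by
  have h1 : ∀ p ∈ S.powersetCard 2, ∃ f : Edge α, f.2 ∈ V.edges f.1 ∧
      ∃ i j, i ≠ j ∧ p = {i, j} ∧ Splits f i j := by
    intro p hp
    obtain ⟨hp1, hp2⟩ := Finset.mem_powersetCard.1 hp
    obtain ⟨i, j, hij, rfl⟩ := Finset.card_eq_two.1 hp2
    obtain ⟨f, hf, hs⟩ := hV.exists_splits_of_mem hij (hp1 (by simp)) (hp1 (by simp))
    exact ⟨f, hf, i, j, hij, rfl, hs⟩
  have : Nonempty (Edge α) := ⟨f⟩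
  choose! φ hφ1 hφ2 using h1
  have hpair : ∀ f : Edge α, f.2 ∈ V.edges f.1 → ∀ i j i' j' : α, Splits f i j →
      Splits f i' j' → ({i, j} : Finset α) = {i', j'} := by
    intro f hf i j i' j' h h'
    rcases hV.splits_unique hf h h' with ⟨rfl, rfl⟩ | ⟨rfl, rfl⟩
    · rfl
    · exact Finset.pair_comm _ _
  have hinj : Set.InjOn φ ((S.powersetCard 2 : Finset (Finset α)) : Set (Finset α)) := by
    intro p hp q hq hpq
    obtain ⟨i, j, -, hp', hs⟩ := hφ2 p hp
    obtain ⟨i', j', -, hq', hs'⟩ := hφ2 q hq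
    rw [hpq] at hs
    rw [hp', hq']
    exact hpair _ (hφ1 q hq) _ _ _ _ hs hs'
  have hsurj : Set.SurjOn φ ((S.powersetCard 2 : Finset (Finset α)) : Set (Finset α)) hV.edgeFinset :=
    Finset.surjOn_of_injOn_of_card_le φ (fun p hp => hV.mem_edgeFinset.2 (hφ1 p hp)) hinj
      (by rw [hV.card_edgeFinset, Finset.card_powersetCard])
  have key : ∀ f : Edge α, f.2 ∈ V.edges f.1 → ∃ i j, i ≠ j ∧ Splits f i j ∧ φ {i, j} = f := by
    intro f hf
    obtain ⟨p, hp, rfl⟩ := hsurj (hV.mem_edgeFinset.2 hf)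
    obtain ⟨i, j, hij, hp', hs⟩ := hφ2 p hp
    exact ⟨i, j, hij, hs, by rw [← hp']⟩
  constructor
  · obtain ⟨i, j, hij, hs, -⟩ := key f hf
    exact ⟨i, j, hij, hs⟩
  · intro i j hs g hg hs'
    obtain ⟨i1, j1, -, hs1, rfl⟩ := key f hf
    obtain ⟨i2, j2, -, hs2, rfl⟩ := key g hg
    rw [hpair _ hg _ _ _ _ hs2 hs', hpair _ hf _ _ _ _ hs1 hs]

lemma HasCondPair.splits {k : ℕ} {x y : Node α k} {a b : α} (h : HasCondPair x y a b) :
    Splits ⟨k, s(x, y)⟩ a b :=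
  ⟨x, y, rfl, h.left_mem.1, h.left_mem.2, h.right_mem.1, h.right_mem.2⟩

lemma IsVine.hasCondPair_of_mem (hV : IsVine S V) {k : ℕ} {x y : Node α k}
    (he : s(x, y) ∈ V.edges k) {a b : α} (h1 : a ∈ completeUnion k x) (h2 : a ∉ completeUnion k y)
    (h3 : b ∈ completeUnion k y) (h4 : b ∉ completeUnion k x) : HasCondPair x y a b := by
  have he' : s(y, x) ∈ V.edges k := by rwa [Sym2.eq_swap]
  constructor
  · rw [condPart_eq]
    exact Set.Subsingleton.eq_singleton_of_mem (hV.diff_subsingleton he) ⟨h1, h2⟩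
  · rw [condPart_eq]
    exact Set.Subsingleton.eq_singleton_of_mem (hV.diff_subsingleton he') ⟨h3, h4⟩

/-- `IsVine.diff_subsingleton` gives at most one element on each side; that the sides are nonempty
comes from the counting argument. -/
lemma IsVine.exists_hasCondPair (hV : IsVine S V) {k : ℕ} {x y : Node α k}
    (he : s(x, y) ∈ V.edges k) : ∃ a b, HasCondPair x y a b := by
  obtain ⟨i, j, -, x', y', hxy, h1, h2, h3, h4⟩ := (hV.exists_splits_inj (f := ⟨k, s(x, y)⟩) he).1
  rcases Sym2.eq_iff.1 hxy with ⟨rfl, rfl⟩ | ⟨rfl, rfl⟩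
  · exact ⟨i, j, hV.hasCondPair_of_mem he h1 h2 h3 h4⟩
  · exact ⟨j, i, hV.hasCondPair_of_mem he h3 h4 h1 h2⟩

lemma IsVine.eq_of_splits (hV : IsVine S V) {f g : Edge α} (hf : f.2 ∈ V.edges f.1)
    (hg : g.2 ∈ V.edges g.1) {i j : α} (h1 : Splits f i j) (h2 : Splits g i j) : f = g :=
  (hV.exists_splits_inj hg).2 i j h2 f hf h1

lemma IsVine.exists_edge_hasCondPair (hV : IsVine S V) {i j : α} (hij : i ≠ j) (hi : i ∈ S)
    (hj : j ∈ S) : ∃ (k : ℕ) (x y : Node α k), s(x, y) ∈ V.edges k ∧ HasCondPair x y i j := by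
  obtain ⟨⟨k, e⟩, hf, hs⟩ := hV.exists_splits_of_mem hij hi hj
  change e ∈ V.edges k at hf
  obtain ⟨x, y, hxy, h1, h2, h3, h4⟩ := splits_mk.1 hs
  obtain rfl : e = s(x, y) := hxy
  exact ⟨k, x, y, hf, hV.hasCondPair_of_mem hf h1 h2 h3 h4⟩

lemma IsVine.ncard_completeUnion (hV : IsVine S V) : ∀ {k : ℕ} {v : Node α k},
    v ∈ V.verts k → (completeUnion k v).ncard = k + 1
  | 0, v, _ => by simp
  | k + 1, e, he => by
    induction e using Sym2.ind with
    | _ x y =>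
      obtain ⟨a, b, h⟩ := hV.exists_hasCondPair he
      rw [h.completeUnion_eq, Set.ncard_insert_of_notMem h.left_mem.2
        (S.finite_toSet.subset (hV.completeUnion_subset (hV.right_mem he))),
        hV.ncard_completeUnion (hV.right_mem he)]

/-- Look at the pair split by `f`. If one end contains it, some edge inside that end splits it, and
this edge is `f` by uniqueness; otherwise the edge `{x, y}` splits it. So inclusion of complete
unions reflects descent in the vine. -/
lemma IsVine.union_subset_cases (hV : IsVine S V) {k : ℕ} {x y : Node α k}
    (he : s(x, y) ∈ V.edges k) {f : Edge α} (hf : f.2 ∈ V.edges f.1)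
    (hfe : f.union ⊆ completeUnion (k + 1) s(x, y)) :
    f = ⟨k, s(x, y)⟩ ∨ f.union ⊆ completeUnion k x ∨ f.union ⊆ completeUnion k y := by
  obtain ⟨i, j, hij, hs⟩ := (hV.exists_splits_inj hf).1
  have hmem : i ∈ f.union ∧ j ∈ f.union := by
    obtain ⟨p, q, hpq, h1, h2, h3, h4⟩ := hs
    rw [Edge.union, hpq, completeUnion_mk]
    exact ⟨.inl h1, .inr h3⟩
  have hi := hfe hmem.1
  have hj := hfe hmem.2
  rw [completeUnion_mk] at hi hj
  simp only [Set.mem_union] at hi hj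
  by_cases h1 : i ∈ completeUnion k x ∧ j ∈ completeUnion k x
  · obtain ⟨g, hg, hs', hu⟩ := hV.exists_splits hij (hV.left_mem he) h1.1 h1.2
    rw [hV.eq_of_splits hg hf hs' hs] at hu
    exact .inr (.inl hu)
  by_cases h2 : i ∈ completeUnion k y ∧ j ∈ completeUnion k y
  · obtain ⟨g, hg, hs', hu⟩ := hV.exists_splits hij (hV.right_mem he) h2.1 h2.2
    rw [hV.eq_of_splits hg hf hs' hs] at hu
    exact .inr (.inr hu)
  refine .inl (hV.eq_of_splits hf he hs ?_)
  by_cases h3 : i ∈ completeUnion k x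
  · exact ⟨x, y, rfl, h3, by tauto, by tauto, by tauto⟩
  · exact ⟨y, x, Sym2.eq_swap, by tauto, by tauto, by tauto, by tauto⟩

lemma IsVine.ncard_union (hV : IsVine S V) {f : Edge α} (hf : f.2 ∈ V.edges f.1) :
    f.union.ncard = f.1 + 2 := hV.ncard_completeUnion hf

lemma IsVine.finite_completeUnion (hV : IsVine S V) {k : ℕ} {v : Node α k}
    (hv : v ∈ V.verts k) : (completeUnion k v).Finite :=
  S.finite_toSet.subset (hV.completeUnion_subset hv)

lemma IsVine.edge_eq_of_union_subset (hV : IsVine S V) {f g : Edge α} (hf : f.2 ∈ V.edges f.1)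
    (hg : g.2 ∈ V.edges g.1) (h : f.union ⊆ g.union) (hl : g.1 ≤ f.1) : f = g := by
  obtain ⟨k, e⟩ := g
  induction e using Sym2.ind with
  | _ x y =>
    dsimp only at *
    have hc := hV.ncard_union hf
    rcases hV.union_subset_cases hg hf h with h1 | h1 | h1
    · exact h1
    · have := Set.ncard_le_ncard h1 (hV.finite_completeUnion (hV.left_mem hg))
      rw [hV.ncard_completeUnion (hV.left_mem hg)] at this
      omega
    · have := Set.ncard_le_ncard h1 (hV.finite_completeUnion (hV.right_mem hg))
      rw [hV.ncard_completeUnion (hV.right_mem hg)] at this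
      omega

lemma IsVine.node_eq_of_completeUnion_eq (hV : IsVine S V) : ∀ {k : ℕ} {v w : Node α k},
    v ∈ V.verts k → w ∈ V.verts k → completeUnion k v = completeUnion k w → v = w
  | 0, v, w, _, _, h => Set.singleton_injective h
  | k + 1, v, w, hv, hw, h => by
    have := hV.edge_eq_of_union_subset (f := ⟨k, v⟩) (g := ⟨k, w⟩) hv hw h.subset le_rfl
    simpa using this

lemma IsVine.mem_restrict (hV : IsVine S V) {B : Finset α} (hB : B ⊆ S) :
    ∀ {k : ℕ} {v : Node α k},
      v ∈ V.restrict B k ↔ v ∈ V.verts k ∧ completeUnion k v ⊆ B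
  | 0, v => by
    rw [hV.verts_zero]
    simp only [GraphSeq.restrict, completeUnion_zero, Set.singleton_subset_iff, Finset.mem_coe]
    exact ⟨fun h => ⟨hB h, h⟩, fun h => h.2⟩
  | k + 1, e => by
    change (e ∈ V.edges k ∧ ∀ v ∈ e, v ∈ V.restrict B k) ↔ e ∈ V.edges k ∧ _
    refine and_congr_right fun he => ?_
    induction e using Sym2.ind with
    | _ x y =>
      rw [completeUnion_mk, Set.union_subset_iff]
      simp only [Sym2.mem_iff, forall_eq_or_imp, forall_eq]
      rw [hV.mem_restrict hB, hV.mem_restrict hB]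
      have := hV.left_mem he
      have := hV.right_mem he
      tauto

end Vine
/-! ### Conditional values and edge factors -/

section CondValue

variable {α : Type} {S : Finset α} {V : GraphSeq α} {C : PairCopulas α} {u u' : α → ℝ}

/-- The element `a` fixes the orientation, since it belongs to only one end; the choice made in
`condValue` is therefore forced. -/
lemma HasCondPair.eq_of_mk_eq {k : ℕ} {x y x' y' : Node α k} {a b b' : α}
    (h : HasCondPair x y a b) (h' : HasCondPair x' y' a b') (he : s(x, y) = s(x', y')) :
    x' = x ∧ y' = y ∧ b' = b := by
  rcases Sym2.eq_iff.1 he with ⟨rfl, rfl⟩ | ⟨rfl, rfl⟩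
  · exact ⟨rfl, rfl, (h.unique h').2⟩
  · exact absurd h'.left_mem.1 h.left_mem.2

lemma condValue_mk {k : ℕ} {x y : Node α k} {a b : α} (h : HasCondPair x y a b) :
    condValue C u (k + 1) s(x, y) a =
      ∫ s in (0 : ℝ)..(condValue C u k x a), (C k x y).density s (condValue C u k y b) := by
  have hex : ∃ p : Node α k × Node α k × α,
      s(x, y) = s(p.1, p.2.1) ∧ HasCondPair p.1 p.2.1 a p.2.2 := ⟨(x, y, b), rfl, h⟩
  obtain ⟨h1, h2, h3⟩ := h.eq_of_mk_eq hex.choose_spec.2 hex.choose_spec.1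
  rw [condValue, dif_pos hex, h1, h2, h3]

lemma edgeFactor_mk (hC : C.IsChoiceFor V) {k : ℕ} {x y : Node α k} (he : s(x, y) ∈ V.edges k)
    {a b : α} (h : HasCondPair x y a b) :
    edgeFactor C u k s(x, y) =
      (C k x y).density (condValue C u k x a) (condValue C u k y b) := by
  have hex : ∃ p : Node α k × Node α k × α × α,
      s(x, y) = s(p.1, p.2.1) ∧ HasCondPair p.1 p.2.1 p.2.2.1 p.2.2.2 := ⟨(x, y, a, b), rfl, h⟩
  rw [edgeFactor, dif_pos hex]
  obtain ⟨h1, h2⟩ := hex.choose_spec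
  generalize hex.choose = p at h1 h2
  obtain ⟨x', y', a', b'⟩ := p
  dsimp only at h1 h2
  rcases Sym2.eq_iff.1 h1 with ⟨rfl, rfl⟩ | ⟨rfl, rfl⟩
  · obtain ⟨rfl, rfl⟩ := h.unique h2
    rfl
  · obtain ⟨rfl, rfl⟩ := h.symm.unique h2
    exact hC k x y he _ _

lemma condValue_congr : ∀ {k : ℕ} {v : Node α k} (a : α),
    (∀ i ∈ completeUnion k v, u i = u' i) → condValue C u k v a = condValue C u' k v a
  | 0, v, a, h => h v rfl
  | k + 1, e, a, h => by
    rw [condValue, condValue]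
    split_ifs with hex
    · have h1 := hex.choose_spec.1
      generalize hex.choose = p at h1
      subst h1
      rw [completeUnion_mk] at h
      rw [condValue_congr a fun i hi => h i (.inl hi),
        condValue_congr p.2.2 fun i hi => h i (.inr hi)]
    · rfl

lemma edgeFactor_congr {k : ℕ} {e : Sym2 (Node α k)}
    (h : ∀ i ∈ completeUnion (k + 1) e, u i = u' i) :
    edgeFactor C u k e = edgeFactor C u' k e := by
  rw [edgeFactor, edgeFactor]
  split_ifs with hex
  · have h1 := hex.choose_spec.1
    generalize hex.choose = p at h1
    subst h1
    rw [completeUnion_mk] at h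
    rw [condValue_congr p.2.2.1 fun i hi => h i (.inl hi),
      condValue_congr p.2.2.2 fun i hi => h i (.inr hi)]
  · rfl

lemma PairCopula.intervalIntegrable (c : PairCopula) {v : ℝ} (hv : v ∈ Set.Icc (0 : ℝ) 1) :
    IntervalIntegrable (fun s => c.density s v) volume 0 1 := by
  by_contra h
  have := c.integral_left v hv
  rw [intervalIntegral.integral_undef h] at this
  exact zero_ne_one this

lemma PairCopula.primitive_mem (c : PairCopula) {w v : ℝ} (hw : w ∈ Set.Icc (0 : ℝ) 1)
    (hv : v ∈ Set.Icc (0 : ℝ) 1) : (∫ s in (0 : ℝ)..w, c.density s v) ∈ Set.Icc (0 : ℝ) 1 := by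
  have h0 : ∀ s ∈ Set.Icc (0 : ℝ) 1, 0 ≤ c.density s v := fun s hs => c.nonneg s hs v hv
  refine ⟨intervalIntegral.integral_nonneg hw.1 fun s hs => h0 s ⟨hs.1, hs.2.trans hw.2⟩, ?_⟩
  rw [← c.integral_left v hv]
  refine intervalIntegral.integral_mono_interval le_rfl hw.1 hw.2 ?_ (c.intervalIntegrable hv)
  refine (ae_restrict_iff' measurableSet_Ioc).2 (Filter.Eventually.of_forall fun s hs => ?_)
  exact h0 s ⟨hs.1.le, hs.2⟩

lemma condValue_mem : ∀ {k : ℕ} {v : Node α k} (a : α),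
    (∀ i ∈ completeUnion k v, u i ∈ Set.Icc (0 : ℝ) 1) → condValue C u k v a ∈ Set.Icc (0 : ℝ) 1
  | 0, v, a, h => h v rfl
  | k + 1, e, a, h => by
    rw [condValue]
    split_ifs with hex
    · have h1 := hex.choose_spec.1
      generalize hex.choose = p at h1
      subst h1
      rw [completeUnion_mk] at h
      exact (C k _ _).primitive_mem (condValue_mem a fun i hi => h i (.inl hi))
        (condValue_mem p.2.2 fun i hi => h i (.inr hi))
    · simp

lemma edgeFactor_nonneg {k : ℕ} {e : Sym2 (Node α k)}
    (h : ∀ i ∈ completeUnion (k + 1) e, u i ∈ Set.Icc (0 : ℝ) 1) : 0 ≤ edgeFactor C u k e := by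
  rw [edgeFactor]
  split_ifs with hex
  · have h1 := hex.choose_spec.1
    generalize hex.choose = p at h1
    subst h1
    rw [completeUnion_mk] at h
    exact (C k _ _).nonneg _ (condValue_mem _ fun i hi => h i (.inl hi)) _
      (condValue_mem _ fun i hi => h i (.inr hi))
  · exact zero_le_one

lemma measurable_primitive {Ω : Type*} [MeasurableSpace Ω] {g : ℝ → ℝ → ℝ}
    (hg : Measurable (Function.uncurry g)) {A B : Ω → ℝ} (hA : Measurable A) (hB : Measurable B) :
    Measurable fun ω => ∫ s in (0 : ℝ)..(A ω), g s (B ω) := by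
  -- The indicator of the moving interval turns this into a parameter integral of a function
  -- measurable on the product. The interval integral is a difference of two such integrals, so no
  -- sign condition on `A` is needed.
  have key : ∀ {P Q : Ω → ℝ}, Measurable P → Measurable Q →
      Measurable fun ω => ∫ s in Set.Ioc (P ω) (Q ω), g s (B ω) := by
    intro P Q hP hQ
    have h1 : MeasurableSet {p : Ω × ℝ | P p.1 < p.2 ∧ p.2 ≤ Q p.1} :=
      (measurableSet_lt (hP.comp measurable_fst) measurable_snd).inter
        (measurableSet_le measurable_snd (hQ.comp measurable_fst))
    have h2 : Measurable fun p : Ω × ℝ => g p.2 (B p.1) :=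
      hg.comp (measurable_snd.prodMk (hB.comp measurable_fst))
    have h3 := ((h2.indicator h1).stronglyMeasurable.integral_prod_right' (ν := volume)).measurable
    refine Eq.subst (motive := Measurable) ?_ h3
    funext ω
    rw [← integral_indicator measurableSet_Ioc]
    rfl
  simp only [intervalIntegral]
  exact (key measurable_const hA).sub (key hA measurable_const)

lemma measurable_condValue (C : PairCopulas α) : ∀ (k : ℕ) (v : Node α k) (a : α),
    Measurable fun u : α → ℝ => condValue C u k v a
  | 0, v, a => measurable_pi_apply v
  | k + 1, e, a => by
    simp only [condValue]
    split_ifs with hex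
    · exact measurable_primitive (C k _ _).measurable_density (measurable_condValue C k _ _)
        (measurable_condValue C k _ _)
    · exact measurable_const

lemma measurable_edgeFactor (C : PairCopulas α) (k : ℕ) (e : Sym2 (Node α k)) :
    Measurable fun u : α → ℝ => edgeFactor C u k e := by
  simp only [edgeFactor]
  split_ifs with hex
  · exact (C k _ _).measurable_density.comp
      ((measurable_condValue C k _ _).prodMk (measurable_condValue C k _ _))
  · exact measurable_const

end CondValue

/-! ### The probability integral transform -/

section Transform

open Set

/-- The probability integral transform: the distribution function `H` of a density on `[0, 1]`
pushes that law forward to the uniform one. It suffices to compare the two measures on half-lines.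
-/
lemma lintegral_comp_primitive {g : ℝ → ℝ} (hg : Measurable g) (h0 : ∀ x, 0 ≤ g x)
    (hi : Integrable g) (h1 : ∫ s in (0 : ℝ)..1, g s = 1) {F : ℝ → ENNReal} (hF : Measurable F) :
    ∫⁻ w in Icc (0 : ℝ) 1, F (∫ s in (0 : ℝ)..w, g s) * ENNReal.ofReal (g w) =
      ∫⁻ w in Icc (0 : ℝ) 1, F w := by
  set H : ℝ → ℝ := fun w => ∫ s in (0 : ℝ)..w, g s with hH
  have hii : ∀ a b, IntervalIntegrable g volume a b := fun a b => hi.intervalIntegrable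
  have hcont : Continuous H := intervalIntegral.continuous_primitive hii 0
  have hmono : Monotone H := by
    intro a b hab
    rw [← sub_nonneg]
    change 0 ≤ (∫ s in (0 : ℝ)..b, g s) - ∫ s in (0 : ℝ)..a, g s
    rw [intervalIntegral.integral_interval_sub_left (hii _ _) (hii _ _)]
    exact intervalIntegral.integral_nonneg hab fun s _ => h0 s
  have hH0 : H 0 = 0 := intervalIntegral.integral_same
  have hlin : ∀ w, 0 ≤ w → ∫⁻ s in Icc 0 w, ENNReal.ofReal (g s) = ENNReal.ofReal (H w) := by
    intro w hw
    rw [← ofReal_integral_eq_lintegral_ofReal hi.integrableOn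
      (Filter.Eventually.of_forall h0), integral_Icc_eq_integral_Ioc,
      ← intervalIntegral.integral_of_le hw]
  set μ : Measure ℝ := (volume.restrict (Icc (0 : ℝ) 1)).withDensity fun s => ENNReal.ofReal (g s)
    with hμ
  have hgm : Measurable fun s => ENNReal.ofReal (g s) := hg.ennreal_ofReal
  have hμs : ∀ s, MeasurableSet s →
      μ.map H s = ∫⁻ x in H ⁻¹' s ∩ Icc 0 1, ENNReal.ofReal (g x) := by
    intro s hs
    have hs' : MeasurableSet (H ⁻¹' s) := hcont.measurable hs
    rw [Measure.map_apply hcont.measurable hs, hμ, withDensity_apply _ hs',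
      Measure.restrict_restrict hs']
  have hmap : μ.map H = volume.restrict (Icc (0 : ℝ) 1) := by
    have : IsFiniteMeasure (μ.map H) := by
      refine ⟨?_⟩
      rw [hμs _ MeasurableSet.univ, preimage_univ, univ_inter, hlin 1 zero_le_one]
      exact ENNReal.ofReal_lt_top
    refine Measure.ext_of_Iic _ _ fun t => ?_
    rw [hμs _ measurableSet_Iic, Measure.restrict_apply measurableSet_Iic]
    rcases lt_or_ge t 0 with ht | ht
    · have e1 : H ⁻¹' Iic t ∩ Icc 0 1 = ∅ := by
        ext w
        simp only [mem_inter_iff, mem_preimage, mem_Iic, mem_Icc, mem_empty_iff_false, iff_false]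
        rintro ⟨hw, hw0, -⟩
        have := hmono hw0
        linarith
      have e2 : Iic t ∩ Icc (0 : ℝ) 1 = ∅ := by
        ext w
        simp only [mem_inter_iff, mem_Iic, mem_Icc, mem_empty_iff_false, iff_false]
        rintro ⟨hw, hw0, -⟩
        linarith
      rw [e1, e2]
      simp
    rcases le_or_gt 1 t with ht1 | ht1
    · have e1 : H ⁻¹' Iic t ∩ Icc 0 1 = Icc 0 1 := by
        refine inter_eq_right.2 fun w hw => ?_
        exact (hmono hw.2).trans (h1.le.trans ht1)
      have e2 : Iic t ∩ Icc (0 : ℝ) 1 = Icc 0 1 :=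
        inter_eq_right.2 fun w hw => hw.2.trans ht1
      rw [e1, e2, hlin 1 zero_le_one]
      simp [H, h1]
    · have hK : IsCompact (H ⁻¹' Iic t ∩ Icc 0 1) :=
        isCompact_Icc.inter_left (isClosed_Iic.preimage hcont)
      -- `H` may be constant on intervals, so `w` is taken as the largest point with `H w ≤ t`. The
      -- intermediate value theorem on `[w, 1]` then gives `H w = t`.
      obtain ⟨w, hw, hmax⟩ := hK.exists_isGreatest
        ⟨0, by simp only [mem_preimage, mem_Iic, hH0]; exact ht, by simp⟩
      have hwt : H w = t := by
        obtain ⟨z, hz, hzt⟩ := intermediate_value_Icc hw.2.2 hcont.continuousOn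
          ⟨hw.1, ht1.le.trans h1.ge⟩
        have hzw : z ≤ w := hmax ⟨hzt.le, hw.2.1.trans hz.1, hz.2⟩
        rw [← hzt, le_antisymm hzw hz.1]
      have e1 : H ⁻¹' Iic t ∩ Icc 0 1 = Icc 0 w := by
        ext z
        refine ⟨fun hz => ⟨hz.2.1, hmax hz⟩, fun hz => ⟨?_, hz.1, hz.2.trans hw.2.2⟩⟩
        exact (hmono hz.2).trans hwt.le
      have e2 : Iic t ∩ Icc (0 : ℝ) 1 = Icc 0 t := by
        ext z
        simp only [mem_inter_iff, mem_Iic, mem_Icc]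
        constructor
        · rintro ⟨h1, h2, -⟩
          exact ⟨h2, h1⟩
        · rintro ⟨h1, h2⟩
          exact ⟨h2, h1, by linarith⟩
      rw [e1, e2, hlin w hw.2.1, hwt]
      simp
  conv_rhs => rw [← hmap]
  have h2 := lintegral_withDensity_eq_lintegral_mul (volume.restrict (Icc (0 : ℝ) 1)) hgm
    (hF.comp hcont.measurable)
  rw [lintegral_map hF hcont.measurable]
  refine Eq.trans ?_ h2.symm
  refine lintegral_congr fun w => ?_
  rw [Pi.mul_apply, mul_comm]
  rfl

/-- The density is controlled only on the unit square, so it is cut off outside `[0, 1]` before the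
transform is applied. -/
lemma PairCopula.lintegral_comp_primitive (c : PairCopula) {v : ℝ} (hv : v ∈ Icc (0 : ℝ) 1)
    {F : ℝ → ENNReal} (hF : Measurable F) :
    ∫⁻ w in Icc (0 : ℝ) 1,
      F (∫ s in (0 : ℝ)..w, c.density s v) * ENNReal.ofReal (c.density w v) =
      ∫⁻ w in Icc (0 : ℝ) 1, F w := by
  set g : ℝ → ℝ := (Icc (0 : ℝ) 1).indicator fun s => c.density s v with hg
  have hgm : Measurable fun s => c.density s v :=
    c.measurable_density.comp (measurable_id.prodMk measurable_const)
  have hint : Integrable g := by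
    rw [hg, integrable_indicator_iff measurableSet_Icc, integrableOn_Icc_iff_integrableOn_Ioc,
      ← intervalIntegrable_iff_integrableOn_Ioc_of_le zero_le_one]
    exact c.intervalIntegrable hv
  have hprim : ∀ w ∈ Icc (0 : ℝ) 1,
      ∫ s in (0 : ℝ)..w, g s = ∫ s in (0 : ℝ)..w, c.density s v := by
    intro w hw
    refine intervalIntegral.integral_congr fun s hs => ?_
    rw [uIcc_of_le hw.1] at hs
    exact indicator_of_mem (show s ∈ Icc (0 : ℝ) 1 from ⟨hs.1, hs.2.trans hw.2⟩) _
  rw [← SVine.lintegral_comp_primitive (g := g) (hgm.indicator measurableSet_Icc)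
    (fun s => indicator_nonneg (fun s hs => c.nonneg s hs v hv) s) hint
    (by rw [hprim 1 (by simp), c.integral_left v hv]) hF]
  refine setLIntegral_congr_fun measurableSet_Icc fun w hw => ?_
  rw [hprim w hw, hg, indicator_of_mem hw]

end Transform

/-! ### Marginalisation -/

section Marginal

variable {α : Type} {S : Finset α} {V : GraphSeq α} {C : PairCopulas α} {u u' : α → ℝ}

/-- The element `a` is an endpoint of the conditioned set of the node. -/
def IsCondElem : (k : ℕ) → Node α k → α → Prop
  | 0, v, a => v = a
  | k + 1, e, a => ∃ (x y : Node α k) (b : α), (e : Sym2 (Node α k)) = s(x, y) ∧ HasCondPair x y a b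

/-- This keeps the recursion for `condValue` away from its default value `0`. The node shared by `x`
and `y` misses `a`, so in `x = {z, p}` the element `a` is the conditioned one on the side of `p`. -/
lemma IsVine.isCondElem (hV : IsVine S V) : ∀ {k : ℕ} {x y : Node α k} {a b : α},
    s(x, y) ∈ V.edges k → HasCondPair x y a b → IsCondElem k x a
  | 0, x, y, a, b, _, h => (show a = x from h.left_mem.1).symm
  | k + 1, x, y, a, b, he, h => by
    obtain ⟨z, ⟨hzx, hzy⟩, -⟩ := hV.proximity k x y he
    have hx := hV.left_mem he
    obtain ⟨p, rfl⟩ := Sym2.mem_iff_exists.1 hzx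
    obtain ⟨q, rfl⟩ := Sym2.mem_iff_exists.1 hzy
    have hx' : s(p, z) ∈ V.edges k := by rw [Sym2.eq_swap]; exact hx
    obtain ⟨a', b', h'⟩ := hV.exists_hasCondPair hx'
    have h1 := h.left_mem
    rw [completeUnion_mk, completeUnion_mk] at h1
    have h2 : a ∉ completeUnion k z := fun h => h1.2 (.inl h)
    have h3 : a ∈ completeUnion k p := h1.1.resolve_left h2
    rw [← h'.eq_left h3 h2] at h'
    exact ⟨p, z, b', Sym2.eq_swap, h'⟩

open Classical in
/-- The product of all factors of edges whose complete union is contained in `B`. -/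
noncomputable def IsVine.partialDensity (hV : IsVine S V) (C : PairCopulas α) (B : Set α)
    (u : α → ℝ) : ENNReal :=
  ∏ f ∈ hV.edgeFinset with f.union ⊆ B, ENNReal.ofReal (edgeFactor C u f.1 f.2)

lemma IsVine.vineDensity_eq (hV : IsVine S V) (C : PairCopulas α) (u : α → ℝ) :
    vineDensity S V C u = ∏ f ∈ hV.edgeFinset, edgeFactor C u f.1 f.2 := by
  rw [vineDensity, IsVine.edgeFinset, Finset.prod_sigma]
  refine Finset.prod_congr rfl fun k _ => ?_
  exact finprod_mem_eq_finite_toFinset_prod _ (hV.finite_verts (k + 1))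

lemma IsVine.measurable_vineDensity (hV : IsVine S V) (C : PairCopulas α) :
    Measurable (vineDensity S V C) := by
  have : vineDensity S V C = fun u => ∏ f ∈ hV.edgeFinset, edgeFactor C u f.1 f.2 :=
    funext (hV.vineDensity_eq C)
  rw [this]
  exact Finset.measurable_fun_prod _ fun f _ => measurable_edgeFactor C f.1 f.2

lemma IsVine.measurable_partialDensity (hV : IsVine S V) (C : PairCopulas α) (B : Set α) :
    Measurable (hV.partialDensity C B) :=
  Finset.measurable_fun_prod _ fun f _ => (measurable_edgeFactor C f.1 f.2).ennreal_ofReal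

lemma IsVine.partialDensity_congr (hV : IsVine S V) {B : Set α} (h : ∀ i ∈ B, u i = u' i) :
    hV.partialDensity C B u = hV.partialDensity C B u' := by
  classical
  refine Finset.prod_congr rfl fun f hf => ?_
  rw [edgeFactor_congr fun i hi => h i ((Finset.mem_filter.1 hf).2 hi)]

lemma IsVine.ofReal_vineDensity (hV : IsVine S V) (C : PairCopulas α) {u : α → ℝ}
    (hu : ∀ i, u i ∈ Set.Icc (0 : ℝ) 1) :
    ENNReal.ofReal (vineDensity S V C u) = hV.partialDensity C S u := by
  classical
  rw [hV.vineDensity_eq, ENNReal.ofReal_prod_of_nonneg fun f _ => edgeFactor_nonneg fun i _ => hu i,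
    IsVine.partialDensity, Finset.filter_true_of_mem]
  exact fun f hf => hV.completeUnion_subset (k := f.1 + 1) (hV.mem_edgeFinset.1 hf)

open Classical in
-- Under the factors involving `a`, the value `u_{a | D}` is uniform when the other coordinates are
-- fixed. For `{x, y}` put `z = u_{a | D'}`, the value at `x`; the value `w` at `y` does not involve
-- `a`. The new value and the top factor are functions of `z`, so the induction hypothesis at `x`
-- makes `z` uniform, and the probability integral transform for `c (·, w)` finishes the step. This
-- is why a general `F` is carried along.
lemma IsVine.lintegral_condValue_mul [DecidableEq α] (hV : IsVine S V) (hC : C.IsChoiceFor V) :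
    ∀ {k : ℕ} {v : Node α k} {a : α} (F : ℝ → ENNReal), Measurable F → v ∈ V.verts k →
      IsCondElem k v a → (∀ i ∈ completeUnion k v, i ≠ a → u i ∈ Set.Icc (0 : ℝ) 1) →
      ∫⁻ t in Set.Icc (0 : ℝ) 1, F (condValue C (Function.update u a t) k v a) *
        ∏ f ∈ hV.edgeFinset with a ∈ f.union ∧ f.union ⊆ completeUnion k v,
          ENNReal.ofReal (edgeFactor C (Function.update u a t) f.1 f.2) =
      ∫⁻ t in Set.Icc (0 : ℝ) 1, F t
  | 0, v, a, F, hF, hv, ha, hu => by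
    obtain rfl : v = a := ha
    have hempty : hV.edgeFinset.filter (fun f => v ∈ f.union ∧ f.union ⊆ completeUnion 0 v) = ∅ := by
      refine Finset.filter_eq_empty_iff.2 fun f hf h => ?_
      have h1 := hV.ncard_union (hV.mem_edgeFinset.1 hf)
      have h2 := Set.ncard_le_ncard h.2 (hV.finite_completeUnion hv)
      rw [hV.ncard_completeUnion hv] at h2
      omega
    rw [hempty]
    simp [condValue]
  | k + 1, e, a, F, hF, he, ha, hu => by
    obtain ⟨x, y, b, rfl, h⟩ := ha
    have hx := hV.left_mem he
    have hnot : (⟨k, s(x, y)⟩ : Edge α) ∉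
        hV.edgeFinset.filter (fun f => a ∈ f.union ∧ f.union ⊆ completeUnion k x) := by
      intro hmem
      have h1 := (Finset.mem_filter.1 hmem).2.2
      have h2 := Set.ncard_le_ncard h1 (hV.finite_completeUnion hx)
      rw [hV.ncard_completeUnion hx, hV.ncard_union (f := ⟨k, s(x, y)⟩) he] at h2
      dsimp only at h2
      omega
    -- As `y` misses `a`, the edges below `{x, y}` that contain `a` are the top edge and those below
    -- `x`.
    have hfilter : hV.edgeFinset.filter
        (fun f => a ∈ f.union ∧ f.union ⊆ completeUnion (k + 1) s(x, y)) =
        insert (⟨k, s(x, y)⟩ : Edge α)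
          (hV.edgeFinset.filter fun f => a ∈ f.union ∧ f.union ⊆ completeUnion k x) := by
      ext f
      simp only [Finset.mem_filter, Finset.mem_insert]
      constructor
      · rintro ⟨hf, haf, hfu⟩
        rcases hV.union_subset_cases he (hV.mem_edgeFinset.1 hf) hfu with h1 | h1 | h1
        · exact .inl h1
        · exact .inr ⟨hf, haf, h1⟩
        · exact absurd (h1 haf) h.left_mem.2
      · rintro (rfl | ⟨hf, haf, hfu⟩)
        · refine ⟨hV.mem_edgeFinset.2 he, ?_, subset_rfl⟩
          rw [Edge.union, completeUnion_mk]
          exact .inl h.left_mem.1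
        · refine ⟨hf, haf, hfu.trans ?_⟩
          rw [completeUnion_mk]
          exact Set.subset_union_left
    have huy : ∀ i ∈ completeUnion k y, u i ∈ Set.Icc (0 : ℝ) 1 := by
      intro i hi
      refine hu i (by rw [completeUnion_mk]; exact .inr hi) ?_
      rintro rfl
      exact h.left_mem.2 hi
    have hw : ∀ t, condValue C (Function.update u a t) k y b = condValue C u k y b := by
      intro t
      refine condValue_congr b fun i hi => Function.update_of_ne ?_ _ _
      rintro rfl
      exact h.left_mem.2 hi
    have hwm := condValue_mem (C := C) b huy
    set w := condValue C u k y b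
    have hcm : Measurable fun z => (C k x y).density z w :=
      (C k x y).measurable_density.comp (measurable_id.prodMk measurable_const)
    have hFm : Measurable fun z => F (∫ s in (0 : ℝ)..z, (C k x y).density s w) :=
      hF.comp (measurable_primitive (C k x y).measurable_density measurable_id measurable_const)
    rw [hfilter]
    simp only [Finset.prod_insert hnot]
    rw [← (C k x y).lintegral_comp_primitive hwm hF, ← hV.lintegral_condValue_mul hC
      (fun z => F (∫ s in (0 : ℝ)..z, (C k x y).density s w) *
        ENNReal.ofReal ((C k x y).density z w)) (hFm.mul hcm.ennreal_ofReal) hx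
      (hV.isCondElem he h)
      fun i hi => hu i (by rw [completeUnion_mk]; exact .inl hi)]
    refine lintegral_congr fun t => ?_
    rw [condValue_mk h, edgeFactor_mk hC he h, hw, mul_assoc]

/-- The factors containing `a` integrate to one, by the preceding lemma with `F = 1`; the others do
not depend on the coordinate `a`. -/
lemma IsVine.lintegral_partialDensity (hV : IsVine S V) (hC : C.IsChoiceFor V) [DecidableEq α]
    {k : ℕ} {x y : Node α k} {a b : α} (he : s(x, y) ∈ V.edges k) (h : HasCondPair x y a b)
    (hu : ∀ i ∈ completeUnion k y, u i ∈ Set.Icc (0 : ℝ) 1) :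
    ∫⁻ t in Set.Icc (0 : ℝ) 1,
      hV.partialDensity C (completeUnion (k + 1) s(x, y)) (Function.update u a t) =
      hV.partialDensity C (completeUnion k y) u := by
  classical
  have hsplit : ∀ t, hV.partialDensity C (completeUnion (k + 1) s(x, y)) (Function.update u a t) =
      (∏ f ∈ hV.edgeFinset with a ∈ f.union ∧ f.union ⊆ completeUnion (k + 1) s(x, y),
        ENNReal.ofReal (edgeFactor C (Function.update u a t) f.1 f.2)) *
        hV.partialDensity C (completeUnion k y) u := by
    intro t
    have hupd : hV.partialDensity C (completeUnion k y) u =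
        hV.partialDensity C (completeUnion k y) (Function.update u a t) := by
      refine hV.partialDensity_congr fun i hi => (Function.update_of_ne ?_ _ _).symm
      rintro rfl
      exact h.left_mem.2 hi
    rw [hupd, IsVine.partialDensity, IsVine.partialDensity,
      ← Finset.prod_filter_mul_prod_filter_not _ (fun f : Edge α => a ∈ f.union),
      Finset.filter_filter, Finset.filter_filter]
    congr 1
    · refine Finset.prod_congr (Finset.filter_congr fun f _ => and_comm) fun f _ => rfl
    · refine Finset.prod_congr (Finset.filter_congr fun f _ => ?_) fun f _ => rfl
      rw [h.completeUnion_eq]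
      constructor
      · rintro ⟨h1, h2⟩ i hi
        rcases h1 hi with rfl | h3
        · exact absurd hi h2
        · exact h3
      · exact fun h1 => ⟨h1.trans (Set.subset_insert _ _), fun h2 => h.left_mem.2 (h1 h2)⟩
  have hmain := hV.lintegral_condValue_mul hC (u := u) (k := k + 1) (v := s(x, y)) (a := a)
    (fun _ => 1) measurable_const he ⟨x, y, b, rfl, h⟩ (by
      intro i hi hia
      rw [h.completeUnion_eq] at hi
      exact hu i (hi.resolve_left hia))
  simp only [one_mul] at hmain
  simp only [hsplit]
  have hm : Measurable fun t => ∏ f ∈ hV.edgeFinset with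
      a ∈ f.union ∧ f.union ⊆ completeUnion (k + 1) s(x, y),
        ENNReal.ofReal (edgeFactor C (Function.update u a t) f.1 f.2) :=
    Finset.measurable_fun_prod _ fun f _ => ((measurable_edgeFactor C f.1 f.2).comp
      (measurable_update u)).ennreal_ofReal
  rw [lintegral_mul_const _ hm]
  have h1 : ∫⁻ t in Set.Icc (0 : ℝ) 1, (1 : ENNReal) = 1 := by simp
  rw [h1] at hmain
  exact (congrArg (· * _) hmain).trans (one_mul _)

/-- The uniform distributions on `[0, 1]`. -/
noncomputable def unif (α : Type) : α → Measure ℝ := fun _ => volume.restrict (Set.Icc 0 1)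

instance (i : α) : SigmaFinite (unif α i) := by unfold unif; infer_instance

lemma pi_unif (B : Finset α) :
    Measure.pi (fun i : B => unif α i) = volume.restrict (Set.Icc (0 : B → ℝ) 1) := by
  rw [volume_pi, ← Set.pi_univ_Icc, Measure.restrict_pi_pi]
  rfl

lemma measurable_extendZero : Measurable (extendZero : (S → ℝ) → α → ℝ) := by
  refine measurable_pi_lambda _ fun i => ?_
  simp only [extendZero]
  split_ifs
  · exact measurable_pi_apply _
  · exact measurable_const

lemma extendZero_mem {z : S → ℝ} (hz : z ∈ Set.Icc (0 : S → ℝ) 1) (i : α) :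
    extendZero z i ∈ Set.Icc (0 : ℝ) 1 := by
  rw [extendZero]
  split_ifs with hi
  · exact ⟨hz.1 ⟨i, hi⟩, hz.2 ⟨i, hi⟩⟩
  · simp

variable [DecidableEq α]

lemma lmarginal_congr_cube {B : Finset α} {f g : (α → ℝ) → ENNReal} (x : α → ℝ)
    (h : ∀ y : α → ℝ, (∀ i ∈ B, y i ∈ Set.Icc (0 : ℝ) 1) → f y = g y) :
    lmarginal (unif α) B f x = lmarginal (unif α) B g x := by
  rw [lmarginal, lmarginal, pi_unif]
  refine setLIntegral_congr_fun measurableSet_Icc fun z hz => h _ fun i hi => ?_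
  rw [Function.updateFinset, dif_pos hi]
  exact ⟨hz.1 ⟨i, hi⟩, hz.2 ⟨i, hi⟩⟩

/-- Here `j` is the number of elements outside `B`. An edge `{w, v}` enlarges `B` by one element
`a`; the integral is first reduced to `insert a B` by induction, and then `a` is integrated out. -/
lemma IsVine.lmarginal_partialDensity (hV : IsVine S V) (hC : C.IsChoiceFor V) (x₀ : α → ℝ)
    {G : (α → ℝ) → ENNReal} (hG : Measurable G) :
    ∀ (j : ℕ) {k : ℕ} {v : Node α k} (B : Finset α), k + 1 + j = S.card → v ∈ V.verts k →
      completeUnion k v = B → (∀ x x', (∀ i ∈ B, x i = x' i) → G x = G x') →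
      lmarginal (unif α) S (fun x => G x * hV.partialDensity C S x) x₀ =
        lmarginal (unif α) B (fun x => G x * hV.partialDensity C B x) x₀
  | 0, k, v, B, hk, hv, hB, _ => by
    have h1 := hV.completeUnion_subset hv
    rw [hB] at h1
    have h2 := hV.ncard_completeUnion hv
    rw [hB, Set.ncard_coe_finset] at h2
    rw [Finset.eq_of_subset_of_card_le (Finset.coe_subset.1 h1) (by omega)]
  | j + 1, k, v, B, hk, hv, hB, hGB => by
    obtain ⟨w, hw⟩ := hV.exists_edge (by omega) hv
    rw [Sym2.eq_swap] at hw
    obtain ⟨a, b, h⟩ := hV.exists_hasCondPair hw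
    have hu : completeUnion (k + 1) s(w, v) = (insert a B : Finset α) := by
      rw [h.completeUnion_eq, hB, Finset.coe_insert]
    have ha : a ∉ B := by
      have := h.left_mem.2
      rwa [hB] at this
    rw [hV.lmarginal_partialDensity hC x₀ hG j (insert a B) (by omega) hw hu
      fun x x' hx => hGB x x' fun i hi => hx i (Finset.mem_insert_of_mem hi)]
    have hm : Measurable fun x => G x * hV.partialDensity C (insert a B : Finset α) x :=
      hG.mul (hV.measurable_partialDensity C _)
    rw [lmarginal_insert' _ hm ha]
    refine lmarginal_congr_cube x₀ fun y hy => ?_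
    have e1 : ∀ t, G (Function.update y a t) = G y := fun t =>
      hGB _ _ fun i hi => Function.update_of_ne (by rintro rfl; exact ha hi) _ _
    simp only [e1]
    have hm2 : Measurable fun t : ℝ =>
        hV.partialDensity C (insert a B : Finset α) (Function.update y a t) :=
      (hV.measurable_partialDensity C _).comp (measurable_update y)
    rw [lintegral_const_mul _ hm2,
      ← hu, ← hB, unif, hV.lintegral_partialDensity hC hw h]
    intro i hi
    rw [hB] at hi
    exact hy i hi

lemma updateFinset_zero (u : S → ℝ) : Function.updateFinset (0 : α → ℝ) S u = extendZero u := by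
  funext i
  simp only [Function.updateFinset, extendZero]
  congr

lemma IsVine.lintegral_vineLaw (hV : IsVine S V) (C : PairCopulas α) {F : (α → ℝ) → ENNReal}
    (hF : Measurable F) :
    ∫⁻ u, F (extendZero u) ∂vineLaw S V C =
      lmarginal (unif α) S (fun x => F x * hV.partialDensity C S x) 0 := by
  have hm : Measurable fun u : S → ℝ => ENNReal.ofReal (vineDensity S V C (extendZero u)) :=
    ((hV.measurable_vineDensity C).comp measurable_extendZero).ennreal_ofReal
  rw [vineLaw, lmarginal, pi_unif]
  refine (lintegral_withDensity_eq_lintegral_mul _ hm (hF.comp measurable_extendZero)).trans ?_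
  refine setLIntegral_congr_fun measurableSet_Icc fun z hz => ?_
  rw [updateFinset_zero, Pi.mul_apply, Function.comp_apply, mul_comm,
    hV.ofReal_vineDensity C (extendZero_mem hz)]

/-- The marginal law of a vine copula model on the complete union of a node. -/
lemma IsVine.lintegral_vineLaw_of_node (hV : IsVine S V) (hC : C.IsChoiceFor V) {k : ℕ}
    {v : Node α k} {B : Finset α} (hv : v ∈ V.verts k) (hB : completeUnion k v = B)
    {F : (α → ℝ) → ENNReal} (hF : Measurable F)
    (hFB : ∀ x x', (∀ i ∈ B, x i = x' i) → F x = F x') :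
    ∫⁻ u, F (extendZero u) ∂vineLaw S V C =
      lmarginal (unif α) B (fun x => F x * hV.partialDensity C B x) 0 := by
  have h1 := Set.ncard_le_ncard (hV.completeUnion_subset hv)
  rw [hV.ncard_completeUnion hv, Set.ncard_coe_finset] at h1
  rw [hV.lintegral_vineLaw C hF]
  exact hV.lmarginal_partialDensity hC 0 hF (S.card - (k + 1)) B (by omega) hv hB hFB

end Marginal

/-! ### Shifts of labels -/

section Shift

variable {d : ℕ} {τ σ : ℤ}

@[simp] lemma shift_fst (v : ℤ × Fin d) : (shift τ v).1 = v.1 + τ := rfl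

lemma shift_shift (v : ℤ × Fin d) : shift τ (shift σ v) = shift (τ + σ) v := by
  simp [shift, add_comm, add_left_comm]

lemma shift_zero (v : ℤ × Fin d) : shift 0 v = v := by simp [shift]

lemma image_shift_shift (A : Set (ℤ × Fin d)) : shift τ '' (shift σ '' A) = shift (τ + σ) '' A := by
  rw [Set.image_image]
  simp only [shift_shift]

lemma image_shift_zero (A : Set (ℤ × Fin d)) : shift 0 '' A = A := by
  simp only [shift_zero, Set.image_id']

lemma shift_injective (τ : ℤ) : Function.Injective (shift (d := d) τ) := by
  intro v w h
  have := congrArg (shift (-τ)) h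
  simpa [shift_shift, shift_zero] using this

lemma mem_block {s t : ℤ} {v : ℤ × Fin d} : v ∈ block d s t ↔ s ≤ v.1 ∧ v.1 ≤ t := by
  simp [block]

variable {k l m : ℕ}

lemma IsShiftOriented.swap {x y : Node (ℤ × Fin d) k} {x' y' : Node (ℤ × Fin d) l}
    (h : IsShiftOriented τ x y x' y') : IsShiftOriented τ y x y' x' :=
  ⟨h.2.1, h.1, by rw [condSet_comm y, condSet_comm y']; exact h.2.2⟩

lemma IsShiftOriented.trans {x y : Node (ℤ × Fin d) k} {x' y' : Node (ℤ × Fin d) l}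
    {x'' y'' : Node (ℤ × Fin d) m}
    (h : IsShiftOriented τ x y x' y') (h' : IsShiftOriented σ x' y' x'' y'') :
    IsShiftOriented (τ + σ) x y x'' y'' := by
  obtain ⟨h1, h2, h3⟩ := h
  obtain ⟨h1', h2', h3'⟩ := h'
  exact ⟨by rw [h1, h1', image_shift_shift], by rw [h2, h2', image_shift_shift],
    by rw [h3, h3', image_shift_shift]⟩

lemma IsShiftOriented.symm {x y : Node (ℤ × Fin d) k} {x' y' : Node (ℤ × Fin d) l}
    (h : IsShiftOriented τ x y x' y') : IsShiftOriented (-τ) x' y' x y := by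
  obtain ⟨h1, h2, h3⟩ := h
  refine ⟨?_, ?_, ?_⟩ <;> simp only [h1, h2, h3, image_shift_shift, neg_add_cancel, image_shift_zero]

lemma IsShift.symm {e : Sym2 (Node (ℤ × Fin d) k)} {e' : Sym2 (Node (ℤ × Fin d) l)}
    (h : IsShift τ e e') : IsShift (-τ) e' e := by
  obtain ⟨x, y, x', y', h1, h2, h3⟩ := h
  exact ⟨x', y', x, y, h2, h1, h3.symm⟩

lemma IsShift.exists_oriented {e : Sym2 (Node (ℤ × Fin d) k)} {x' y' : Node (ℤ × Fin d) l}
    (h : IsShift τ e s(x', y')) : ∃ x y, e = s(x, y) ∧ IsShiftOriented τ x y x' y' := by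
  obtain ⟨x, y, x'', y'', h1, h2, h3⟩ := h
  rcases Sym2.eq_iff.1 h2 with ⟨rfl, rfl⟩ | ⟨rfl, rfl⟩
  · exact ⟨x, y, h1, h3⟩
  · exact ⟨y, x, by rw [h1, Sym2.eq_swap], h3.swap⟩

lemma IsShift.trans {e : Sym2 (Node (ℤ × Fin d) k)} {e' : Sym2 (Node (ℤ × Fin d) l)}
    {e'' : Sym2 (Node (ℤ × Fin d) m)} (h : IsShift τ e e') (h' : IsShift σ e' e'') :
    IsShift (τ + σ) e e'' := by
  obtain ⟨x, y, x', y', rfl, rfl, h3⟩ := h'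
  obtain ⟨p, q, rfl, h4⟩ := h.exists_oriented
  exact ⟨p, q, x', y', rfl, rfl, h4.trans h3⟩

lemma IsShiftOriented.completeUnion_left {x y : Node (ℤ × Fin d) k} {x' y' : Node (ℤ × Fin d) l}
    (h : IsShiftOriented τ x y x' y') : completeUnion k x = shift τ '' completeUnion l x' := by
  have key : ∀ {k : ℕ} (x y : Node (ℤ × Fin d) k),
      completeUnion k x = condPart x y ∪ condSet x y := by
    intro k x y
    rw [condPart, condSet]
    simp
  rw [key x y, key x' y', Set.image_union, ← h.1, ← h.2.2]

lemma IsShiftOriented.completeUnion_right {x y : Node (ℤ × Fin d) k}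
    {x' y' : Node (ℤ × Fin d) l} (h : IsShiftOriented τ x y x' y') :
    completeUnion k y = shift τ '' completeUnion l y' := h.swap.completeUnion_left

lemma IsShift.completeUnion_eq {e : Sym2 (Node (ℤ × Fin d) k)} {e' : Sym2 (Node (ℤ × Fin d) l)}
    (h : IsShift τ e e') : completeUnion (k + 1) e = shift τ '' completeUnion (l + 1) e' := by
  obtain ⟨x, y, x', y', rfl, rfl, h⟩ := h
  rw [completeUnion_mk, completeUnion_mk, h.completeUnion_left, h.completeUnion_right,
    Set.image_union]

lemma IsShiftOriented.hasCondPair {x y : Node (ℤ × Fin d) k} {x' y' : Node (ℤ × Fin d) l}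
    {a b : ℤ × Fin d} (h : IsShiftOriented τ x y x' y') (h' : HasCondPair x' y' a b) :
    HasCondPair x y (shift τ a) (shift τ b) := by
  constructor
  · rw [h.1, h'.1, Set.image_singleton]
  · rw [h.2.1, h'.2, Set.image_singleton]

end Shift

/-! ### Translated restrictions have the same law -/

section Translate

variable {d : ℕ} {τ : ℤ} {S B : Finset (ℤ × Fin d)} {V : GraphSeq (ℤ × Fin d)}
  {C : PairCopulas (ℤ × Fin d)}

/-- Every edge of `V` inside `B` has a translate in `V`. -/
def HasTranslates (V : GraphSeq (ℤ × Fin d)) (B : Finset (ℤ × Fin d)) (τ : ℤ) : Prop :=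
  ∀ (k : ℕ) (e : Sym2 (Node (ℤ × Fin d) k)), e ∈ V.edges k → completeUnion (k + 1) e ⊆ B →
    ∃ e' ∈ V.edges k, IsShift τ e' e

/-- A node is determined by its level and complete union, so an edge with the shifted complete union
must be the translate, label and copula included. -/
lemma HasTranslates.exists_oriented (hV : IsVine S V) (hC : TranslationInvariant V C)
    (hB : HasTranslates V B τ) {k : ℕ} {x y : Node (ℤ × Fin d) k} {a b : ℤ × Fin d}
    {e : Sym2 (Node (ℤ × Fin d) k)} (hxy : s(x, y) ∈ V.edges k) (he : e ∈ V.edges k)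
    (hs : completeUnion (k + 1) s(x, y) ⊆ B)
    (heq : completeUnion (k + 1) e = shift τ '' completeUnion (k + 1) s(x, y))
    (h : HasCondPair x y a b) : ∃ p q, e = s(p, q) ∧ HasCondPair p q (shift τ a) (shift τ b) ∧
      completeUnion k p = shift τ '' completeUnion k x ∧
      completeUnion k q = shift τ '' completeUnion k y ∧ C k p q = C k x y := by
  obtain ⟨e', he', h1⟩ := hB k _ hxy hs
  have : e' = e := hV.node_eq_of_completeUnion_eq (k := k + 1) he' he
    (h1.completeUnion_eq.trans heq.symm)
  subst this
  obtain ⟨p, q, rfl, h2⟩ := h1.exists_oriented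
  exact ⟨p, q, rfl, h2.hasCondPair h, h2.completeUnion_left, h2.completeUnion_right,
    hC τ k k p q x y he' hxy h2⟩

lemma HasTranslates.condValue_eq (hV : IsVine S V) (hC : TranslationInvariant V C)
    (hB : HasTranslates V B τ) (u : ℤ × Fin d → ℝ) : ∀ {k : ℕ} {v w : Node (ℤ × Fin d) k}
    {a : ℤ × Fin d}, v ∈ V.verts k → w ∈ V.verts k → completeUnion k v ⊆ B →
      completeUnion k w = shift τ '' completeUnion k v → IsCondElem k v a →
      condValue C u k w (shift τ a) = condValue C (fun i => u (shift τ i)) k v a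
  | 0, v, w, a, _, _, _, heq, _ => by
    rw [completeUnion_zero, completeUnion_zero, Set.image_singleton] at heq
    rw [condValue, condValue, Set.singleton_injective heq]
  | k + 1, v, w, a, hv, hw, hs, heq, ha => by
    obtain ⟨x, y, b, rfl, h⟩ := ha
    obtain ⟨p, q, rfl, h1, hp, hq, hCpq⟩ := hB.exists_oriented hV hC hv hw hs heq h
    have hs' := hs
    rw [completeUnion_mk, Set.union_subset_iff] at hs'
    have hv' : s(y, x) ∈ V.edges k := by rw [Sym2.eq_swap]; exact hv
    rw [condValue_mk h, condValue_mk h1, hCpq,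
      hB.condValue_eq hV hC u (hV.left_mem hv) (hV.left_mem hw) hs'.1 hp (hV.isCondElem hv h),
      hB.condValue_eq hV hC u (hV.right_mem hv) (hV.right_mem hw) hs'.2 hq
        (hV.isCondElem hv' h.symm)]

lemma HasTranslates.edgeFactor_eq (hV : IsVine S V) (hc : C.IsChoiceFor V)
    (hC : TranslationInvariant V C) (hB : HasTranslates V B τ) (u : ℤ × Fin d → ℝ) {k : ℕ}
    {e e' : Sym2 (Node (ℤ × Fin d) k)} (he : e ∈ V.edges k) (he' : e' ∈ V.edges k)
    (hs : completeUnion (k + 1) e ⊆ B)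
    (heq : completeUnion (k + 1) e' = shift τ '' completeUnion (k + 1) e) :
    edgeFactor C u k e' = edgeFactor C (fun i => u (shift τ i)) k e := by
  induction e using Sym2.ind with
  | _ x y =>
    obtain ⟨a, b, h⟩ := hV.exists_hasCondPair he
    obtain ⟨p, q, rfl, h1, hp, hq, hCpq⟩ := hB.exists_oriented hV hC he he' hs heq h
    rw [completeUnion_mk, Set.union_subset_iff] at hs
    have hv' : s(y, x) ∈ V.edges k := by rw [Sym2.eq_swap]; exact he
    rw [edgeFactor_mk hc he h, edgeFactor_mk hc he' h1, hCpq,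
      hB.condValue_eq hV hC u (hV.left_mem he) (hV.left_mem he') hs.1 hp (hV.isCondElem he h),
      hB.condValue_eq hV hC u (hV.right_mem he) (hV.right_mem he') hs.2 hq
        (hV.isCondElem hv' h.symm)]

/-- Taking translates is a bijection from the edges inside `B` to those inside its shift, with `hB'`
giving surjectivity; corresponding factors agree. -/
lemma HasTranslates.partialDensity_eq (hV : IsVine S V) (hc : C.IsChoiceFor V)
    (hC : TranslationInvariant V C) (hB : HasTranslates V B τ)
    (hB' : HasTranslates V (B.image (shift τ)) (-τ)) (u : ℤ × Fin d → ℝ) :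
    hV.partialDensity C (B.image (shift τ) : Finset _) u =
      hV.partialDensity C B fun i => u (shift τ i) := by
  classical
  symm
  have hsub : ∀ A A' : Set (ℤ × Fin d), A' = shift τ '' A →
      (A' ⊆ (B.image (shift τ) : Finset (ℤ × Fin d)) ↔ A ⊆ B) := by
    rintro A A' rfl
    rw [Finset.coe_image, Set.image_subset_image_iff (shift_injective τ)]
  refine Finset.prod_bij (fun f hf => ⟨f.1, (hB f.1 f.2
    (hV.mem_edgeFinset.1 (Finset.mem_filter.1 hf).1) (Finset.mem_filter.1 hf).2).choose⟩)
    ?_ ?_ ?_ ?_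
  · intro f hf
    obtain ⟨h1, h2⟩ := (hB f.1 f.2 (hV.mem_edgeFinset.1 (Finset.mem_filter.1 hf).1)
      (Finset.mem_filter.1 hf).2).choose_spec
    rw [Finset.mem_filter, hV.mem_edgeFinset]
    exact ⟨h1, (hsub _ _ h2.completeUnion_eq).2 (Finset.mem_filter.1 hf).2⟩
  · intro f hf g hg hfg
    have h1 := (hB f.1 f.2 (hV.mem_edgeFinset.1 (Finset.mem_filter.1 hf).1)
      (Finset.mem_filter.1 hf).2).choose_spec.2
    have h2 := (hB g.1 g.2 (hV.mem_edgeFinset.1 (Finset.mem_filter.1 hg).1)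
      (Finset.mem_filter.1 hg).2).choose_spec.2
    have h3 : f.union = g.union := by
      have := congrArg Edge.union hfg
      refine Set.image_injective.2 (shift_injective τ) ?_
      exact h1.completeUnion_eq.symm.trans (this.trans h2.completeUnion_eq)
    have h4 : f.1 = g.1 := (Sigma.mk.inj_iff.1 hfg).1
    exact hV.edge_eq_of_union_subset (hV.mem_edgeFinset.1 (Finset.mem_filter.1 hf).1)
      (hV.mem_edgeFinset.1 (Finset.mem_filter.1 hg).1) h3.subset h4.ge
  · intro g hg
    obtain ⟨hg1, hg2⟩ := Finset.mem_filter.1 hg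
    obtain ⟨e, he, hs⟩ := hB' g.1 g.2 (hV.mem_edgeFinset.1 hg1) hg2
    have hs' := hs.symm
    rw [neg_neg] at hs'
    have hf : (⟨g.1, e⟩ : Edge (ℤ × Fin d)) ∈ hV.edgeFinset.filter fun f => f.union ⊆ (B : Set (ℤ × Fin d)) := by
      rw [Finset.mem_filter, hV.mem_edgeFinset]
      exact ⟨he, (hsub _ _ hs'.completeUnion_eq).1 hg2⟩
    refine ⟨⟨g.1, e⟩, hf, ?_⟩
    obtain ⟨h1, h2⟩ := (hB g.1 e he (Finset.mem_filter.1 hf).2).choose_spec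
    refine hV.edge_eq_of_union_subset (f := ⟨g.1, _⟩) h1 (hV.mem_edgeFinset.1 hg1) ?_ le_rfl
    exact (h2.completeUnion_eq.trans hs'.completeUnion_eq.symm).subset
  · intro f hf
    obtain ⟨h1, h2⟩ := (hB f.1 f.2 (hV.mem_edgeFinset.1 (Finset.mem_filter.1 hf).1)
      (Finset.mem_filter.1 hf).2).choose_spec
    dsimp only
    rw [hB.edgeFactor_eq hV hc hC u (hV.mem_edgeFinset.1 (Finset.mem_filter.1 hf).1) h1
      (Finset.mem_filter.1 hf).2 h2.completeUnion_eq]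

/-- Both laws are computed on the marginals of `B` and of its shift, which the substitution along
the injective map `shift τ` identifies. -/
lemma HasTranslates.map_eq (hV : IsVine S V) (hc : C.IsChoiceFor V)
    (hC : TranslationInvariant V C) (hB : HasTranslates V B τ)
    (hB' : HasTranslates V (B.image (shift τ)) (-τ)) {k : ℕ} {v v' : Node (ℤ × Fin d) k}
    (hv : v ∈ V.verts k) (hvB : completeUnion k v = B) (hv' : v' ∈ V.verts k)
    (hvB' : completeUnion k v' = (B.image (shift τ) : Finset _)) {m : ℕ} {t : Fin m → ℤ}
    (ht : ∀ i j, (t i, j) ∈ B) :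
    (vineLaw S V C).map (fun u (i : Fin m) (j : Fin d) => extendZero u (t i, j)) =
      (vineLaw S V C).map (fun u (i : Fin m) (j : Fin d) => extendZero u (t i + τ, j)) := by
  have hm : ∀ t : Fin m → ℤ, Measurable fun (u : ℤ × Fin d → ℝ) (i : Fin m) (j : Fin d) =>
      u (t i, j) := fun t =>
    measurable_pi_lambda _ fun i => measurable_pi_lambda _ fun j => measurable_pi_apply _
  refine Measure.ext fun A hA => ?_
  have key : ∀ t : Fin m → ℤ,
      (vineLaw S V C).map (fun u (i : Fin m) (j : Fin d) => extendZero u (t i, j)) A =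
      ∫⁻ u, A.indicator 1 (fun (i : Fin m) (j : Fin d) => extendZero u (t i, j))
        ∂vineLaw S V C := by
    intro t
    rw [← lintegral_indicator_one hA]
    exact lintegral_map (measurable_one.indicator hA) ((hm t).comp measurable_extendZero)
  rw [key t, key fun i => t i + τ]
  have hF : ∀ t : Fin m → ℤ, Measurable fun u : ℤ × Fin d → ℝ =>
      A.indicator (1 : (Fin m → Fin d → ℝ) → ENNReal) (fun i j => u (t i, j)) := fun t =>
    (measurable_one.indicator hA).comp (hm t)
  rw [hV.lintegral_vineLaw_of_node hc hv hvB (hF t),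
    hV.lintegral_vineLaw_of_node hc hv' hvB' (hF fun i => t i + τ)]
  · have h1 := lmarginal_image (μ := unif (ℤ × Fin d)) (shift_injective (d := d) τ) B
      ((hF t).mul (hV.measurable_partialDensity C B)) 0
    refine h1.symm.trans ?_
    congr 1
    funext x
    rw [hB.partialDensity_eq hV hc hC hB']
    rfl
  · intro x x' h
    congr 1
    funext i j
    exact h _ (Finset.mem_image.2 ⟨(t i, j), ht i j, rfl⟩)
  · intro x x' h
    congr 1
    funext i j
    exact h _ (ht i j)

lemma block_subset {T : ℕ} {s t : ℤ} (hs : 1 ≤ s) (ht : t ≤ T) : block d s t ⊆ block d 1 T := by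
  intro v hv
  rw [mem_block] at *
  omega

lemma image_shift_block (s t : ℤ) :
    (block d s t).image (shift τ) = block d (s + τ) (t + τ) := by
  ext v
  rw [Finset.mem_image, mem_block]
  constructor
  · rintro ⟨w, hw, rfl⟩
    rw [mem_block] at hw
    simp only [shift_fst]
    omega
  · intro h
    refine ⟨shift (-τ) v, ?_, by rw [shift_shift, add_neg_cancel, shift_zero]⟩
    rw [mem_block, shift_fst]
    omega

lemma card_block (s : ℤ) (m : ℕ) : (block d s (s + m)).card = (m + 1) * d := by
  rw [block, Finset.card_product, Int.card_Icc, Finset.card_univ, Fintype.card_fin]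
  congr 1
  omega

/-- If the restrictions of a vine to blocks are vines which are translations of each other, then
translation invariant models are stationary. -/
theorem isStationary_of_isTranslation {T d : ℕ} (hd : 1 ≤ d)
    {V : GraphSeq (ℤ × Fin d)} (hV : IsVine (block d 1 T) V)
    {W : ℕ → GraphSeq (ℤ × Fin d)}
    (hW : ∀ m : ℕ, m < T → ∀ t : ℤ, 1 ≤ t → t ≤ T - m →
      IsTranslation m t 1 (V.restrict (block d t (t + m))) (W m))
    {C : PairCopulas (ℤ × Fin d)} (hc : C.IsChoiceFor V) (hC : TranslationInvariant V C) :
    IsStationary T d (vineLaw (block d 1 T) V C) := by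
  intro m t τ _ ht1 hτ htT
  rcases Nat.eq_zero_or_pos m with rfl | hm
  · congr 1
    funext u i
    exact i.elim0
  -- One pair of blocks serves all times: the times `1, …, T - τ` contain every `t i`, and their
  -- shift is `1 + τ, …, T`.
  obtain ⟨M, hM⟩ : ∃ M : ℕ, (M : ℤ) = T - τ - 1 := by
    have := ht1 ⟨0, hm⟩
    have := htT ⟨0, hm⟩
    exact ⟨(T - τ - 1).toNat, Int.toNat_of_nonneg (by omega)⟩
  obtain ⟨hA1, -, hA2⟩ := hW M (by omega) 1 le_rfl (by omega)
  obtain ⟨hB1, -, hB2⟩ := hW M (by omega) (1 + τ) (by omega) (by omega)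
  have hAs : block d 1 (1 + M) ⊆ block d 1 T := block_subset le_rfl (by omega)
  have hBs : block d (1 + τ) (1 + τ + M) ⊆ block d 1 T := block_subset (by omega) (by omega)
  have himg : (block d 1 (1 + M)).image (shift τ) = block d (1 + τ) (1 + τ + M) := by
    rw [image_shift_block, add_right_comm]
  have hMd : 1 ≤ (M + 1) * d := Nat.mul_pos (by omega) hd
  obtain ⟨v, hv, hvU⟩ := hA1.exists_top (k := (M + 1) * d - 1) (by rw [card_block]; omega)
  obtain ⟨v', hv', hvU'⟩ := hB1.exists_top (k := (M + 1) * d - 1) (by rw [card_block]; omega)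
  have hTA : HasTranslates V (block d 1 (1 + M)) τ := by
    intro k e he hs
    obtain ⟨e', he', h1⟩ := (hA2 k).1 e ((hV.mem_restrict hAs (k := k + 1)).2 ⟨he, hs⟩)
    obtain ⟨e'', he'', h2⟩ := (hB2 k).2 e' he'
    refine ⟨e'', ((hV.mem_restrict hBs (k := k + 1)).1 he'').1, ?_⟩
    have := h2.trans h1.symm
    simpa using this
  have hTB : HasTranslates V ((block d 1 (1 + M)).image (shift τ)) (-τ) := by
    intro k e he hs
    rw [himg] at hs
    obtain ⟨e', he', h1⟩ := (hB2 k).1 e ((hV.mem_restrict hBs (k := k + 1)).2 ⟨he, hs⟩)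
    obtain ⟨e'', he'', h2⟩ := (hA2 k).2 e' he'
    refine ⟨e'', ((hV.mem_restrict hAs (k := k + 1)).1 he'').1, ?_⟩
    have := h2.trans h1.symm
    simpa using this
  refine hTA.map_eq hV hc hC hTB ((hV.mem_restrict hAs).1 hv).1 hvU
    ((hV.mem_restrict hBs).1 hv').1 (by rw [hvU', himg]) fun i j => ?_
  rw [mem_block]
  have := ht1 i
  have := htT i
  dsimp only
  omega

end Translate

/-! ### Restrictions which are vines -/

section Restrict

variable {α : Type} {S B : Finset α} {V : GraphSeq α}

lemma isAcyclic_induce_mono {β : Type} {V V' : Set β} {E E' : Set (Sym2 β)} (hV : V' ⊆ V)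
    (hE : E' ⊆ E) (h : ((SimpleGraph.fromEdgeSet E).induce V).IsAcyclic) :
    ((SimpleGraph.fromEdgeSet E').induce V').IsAcyclic := by
  refine h.comap ⟨Set.inclusion hV, ?_⟩ (Set.inclusion_injective hV)
  intro x y hxy
  simp only [SimpleGraph.comap_adj, Function.Embedding.subtype_apply,
    SimpleGraph.fromEdgeSet_adj] at hxy ⊢
  exact ⟨hE hxy.1, hxy.2⟩

lemma GraphSeq.restrict_edges_subset (V : GraphSeq α) (B : Finset α) (k : ℕ) :
    (V.restrict B).edges k ⊆ V.edges k := fun _ he => he.1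

lemma IsVine.restrict_verts_subset (hV : IsVine S V) (hB : B ⊆ S) (k : ℕ) :
    (V.restrict B).verts k ⊆ V.verts k := fun _ hv => ((hV.mem_restrict hB).1 hv).1

lemma IsVine.restrict_edge (hV : IsVine S V) {k : ℕ} :
    ∀ e ∈ (V.restrict B).edges k, ¬ e.IsDiag ∧ ∀ v ∈ e, v ∈ (V.restrict B).verts k :=
  fun _ he => ⟨(hV.edge he.1).2.1, he.2⟩

/-- A subgraph of a tree is a forest, so a nonempty level loses at least one vertex in passing to
its edges. -/
lemma IsVine.ncard_restrict_le (hV : IsVine S V) (hB : B ⊆ S) : ∀ k,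
    ((V.restrict B).verts k).ncard ≤ B.card - k
  | 0 => (Set.ncard_coe_finset B).le
  | k + 1 => by
    have ih := hV.ncard_restrict_le hB k
    change ((V.restrict B).edges k).ncard ≤ _
    rcases ((V.restrict B).edges k).eq_empty_or_nonempty with h | ⟨e, he⟩
    · rw [h, Set.ncard_empty]
      exact Nat.zero_le _
    · have hk := (hV.edge he.1).1
      have hne : ((V.restrict B).verts k).Nonempty := by
        induction e using Sym2.ind with
        | _ x y => exact ⟨x, he.2 x (by simp)⟩
      have := ncard_add_one_le_of_isAcyclic (hV.restrict_edge (B := B))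
        (isAcyclic_induce_mono (hV.restrict_verts_subset hB k) (V.restrict_edges_subset B k)
          (hV.isTree k hk).2.2) ((hV.finite_verts k).subset (hV.restrict_verts_subset hB k)) hne
      omega

open Classical in
lemma IsVine.choose_two_le (hV : IsVine S V) {P : Finset (Edge α)}
    (hP : ∀ f ∈ P, f.2 ∈ V.edges f.1)
    (h : ∀ i ∈ B, ∀ j ∈ B, i ≠ j → ∃ f ∈ P, Splits f i j) : B.card.choose 2 ≤ P.card := by
  rw [← Finset.card_powersetCard]
  refine Finset.card_le_card_of_forall_subsingleton
    (fun p f => ∃ i j, p = {i, j} ∧ Splits f i j) ?_ ?_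
  · intro p hp
    obtain ⟨hp1, hp2⟩ := Finset.mem_powersetCard.1 hp
    obtain ⟨i, j, hij, rfl⟩ := Finset.card_eq_two.1 hp2
    obtain ⟨f, hf, hs⟩ := h i (hp1 (by simp)) j (hp1 (by simp)) hij
    exact ⟨f, hf, i, j, rfl, hs⟩
  · rintro f hf p ⟨-, i, j, rfl, hs⟩ q ⟨-, i', j', rfl, hs'⟩
    rcases hV.splits_unique (hP f hf) hs hs' with ⟨rfl, rfl⟩ | ⟨rfl, rfl⟩
    · rfl
    · exact Finset.pair_comm _ _

/-- By hypothesis every pair in `B` is split by an edge inside `B`, so the restriction has at least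
`B.card.choose 2` edges. The forest bounds of the levels add up to this very number; hence each
bound is attained and each forest is a tree. -/
lemma IsVine.restrict (hV : IsVine S V) (hB : B ⊆ S)
    (h : ∀ (k : ℕ) (x y : Node α k) (a b : α), s(x, y) ∈ V.edges k → HasCondPair x y a b →
      a ∈ B → b ∈ B → completeUnion (k + 1) s(x, y) ⊆ B) : IsVine B (V.restrict B) := by
  classical
  have hfin : ∀ k, ((V.restrict B).verts k).Finite := fun k =>
    (hV.finite_verts k).subset (hV.restrict_verts_subset hB k)
  have hlevel : ∀ (k : ℕ) (e : Sym2 (Node α k)), e ∈ (V.restrict B).edges k →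
      k + 1 < B.card := by
    intro k e he
    obtain ⟨h1, h2⟩ := (hV.mem_restrict hB (k := k + 1)).1 he
    have h3 := Set.ncard_le_ncard h2 B.finite_toSet
    rw [hV.ncard_completeUnion (k := k + 1) h1, Set.ncard_coe_finset] at h3
    omega
  have hcount : ∑ k ∈ Finset.range (B.card - 1), (B.card - (k + 1)) ≤
      ∑ k ∈ Finset.range (B.card - 1), ((V.restrict B).verts (k + 1)).ncard := by
    have h1 := hV.choose_two_le (B := B)
      (P := (Finset.range (B.card - 1)).sigma fun k => (hfin (k + 1)).toFinset) ?_ ?_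
    · rw [sum_range_sub_choose]
      refine h1.trans_eq ?_
      rw [Finset.card_sigma]
      refine Finset.sum_congr rfl fun k _ => ?_
      rw [← Set.ncard_eq_toFinset_card _ (hfin (k + 1))]
    · intro f hf
      rw [Finset.mem_sigma, Set.Finite.mem_toFinset] at hf
      exact V.restrict_edges_subset B _ hf.2
    · intro i hi j hj hij
      obtain ⟨k, x, y, he, hc⟩ := hV.exists_edge_hasCondPair hij (hB hi) (hB hj)
      have he' : s(x, y) ∈ (V.restrict B).edges k :=
        (hV.mem_restrict hB (k := k + 1)).2 ⟨he, h k x y i j he hc hi hj⟩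
      refine ⟨⟨k, s(x, y)⟩, ?_, hc.splits⟩
      rw [Finset.mem_sigma, Set.Finite.mem_toFinset, Finset.mem_range]
      have := hlevel k _ he'
      exact ⟨by dsimp only; omega, he'⟩
  have hle : ∀ k ∈ Finset.range (B.card - 1), ((V.restrict B).verts (k + 1)).ncard ≤
      B.card - (k + 1) := fun k _ => hV.ncard_restrict_le hB (k + 1)
  have heq := (Finset.sum_eq_sum_iff_of_le hle).1 ((Finset.sum_le_sum hle).antisymm hcount)
  have hcard : ∀ k, k < B.card → ((V.restrict B).verts k).ncard = B.card - k := by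
    intro k hk
    cases k with
    | zero => exact Set.ncard_coe_finset B
    | succ k => exact heq k (Finset.mem_range.2 (by omega))
  refine ⟨rfl, fun k hk => ?_, fun k hk => ?_, fun k a b he => ?_⟩
  · refine isTreeOn_of_isAcyclic hV.restrict_edge
      (isAcyclic_induce_mono (hV.restrict_verts_subset hB k) (V.restrict_edges_subset B k)
        (hV.isTree k (hk.trans_le (Finset.card_le_card hB))).2.2) (hfin k) ?_
    rw [hcard k (by omega)]
    have := hcard (k + 1) hk
    change ((V.restrict B).edges k).ncard = _ at this
    omega
  · refine Set.eq_empty_of_forall_notMem fun e he => ?_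
    have := hlevel k e he
    omega
  · exact hV.proximity k a b (V.restrict_edges_subset B _ he)

end Restrict

/-! ### Translation-closed vines and their restrictions to blocks -/

section Closed

variable {T d : ℕ} {V : GraphSeq (ℤ × Fin d)}

/-- Whenever the shift of the conditioned pair of an edge of `V` is in the range of `V`, `V` has an
edge which is the shift of that edge. -/
def TranslationClosed (T : ℕ) (V : GraphSeq (ℤ × Fin d)) : Prop :=
  ∀ (k : ℕ) (x y : Node (ℤ × Fin d) k) (a b : ℤ × Fin d), s(x, y) ∈ V.edges k →
    HasCondPair x y a b → ∀ τ, shift τ a ∈ block d 1 T → shift τ b ∈ block d 1 T →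
      ∃ e' ∈ V.edges k, IsShift τ e' s(x, y)

lemma TranslationClosed.completeUnion_subset (hcl : TranslationClosed T V)
    (hV : IsVine (block d 1 T) V) {s t : ℤ} {k : ℕ} {x y : Node (ℤ × Fin d) k}
    {a b : ℤ × Fin d} (he : s(x, y) ∈ V.edges k) (h : HasCondPair x y a b)
    (ha : a ∈ block d s t) (hb : b ∈ block d s t) :
    completeUnion (k + 1) s(x, y) ⊆ block d s t := by
  have hsub : ∀ τ, shift τ a ∈ block d 1 T → shift τ b ∈ block d 1 T →
      ∀ i ∈ completeUnion (k + 1) s(x, y), shift τ i ∈ block d 1 T := by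
    intro τ h1 h2 i hi
    obtain ⟨e', he', hs⟩ := hcl k x y a b he h τ h1 h2
    refine hV.completeUnion_subset (k := k + 1) he' ?_
    rw [hs.completeUnion_eq]
    exact Set.mem_image_of_mem _ hi
  have ha' := hV.completeUnion_subset (hV.left_mem he) h.left_mem.1
  have hb' := hV.completeUnion_subset (hV.right_mem he) h.right_mem.1
  rw [Finset.mem_coe, mem_block] at ha' hb'
  rw [mem_block] at ha hb
  intro i hi
  -- Push the edge to the right until its conditioned pair touches `T`, and below to the left until
  -- it touches `1`. The translate is an edge of `V` and stays in range, so no element of the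
  -- complete union is later or earlier than both `a` and `b`.
  have h1 := hsub (T - max a.1 b.1) (by rw [mem_block, shift_fst]; omega)
    (by rw [mem_block, shift_fst]; omega) i hi
  have h2 := hsub (1 - min a.1 b.1) (by rw [mem_block, shift_fst]; omega)
    (by rw [mem_block, shift_fst]; omega) i hi
  rw [mem_block, shift_fst] at h1 h2
  rw [Finset.mem_coe, mem_block]
  omega

lemma TranslationClosed.hasTranslate (hcl : TranslationClosed T V)
    (hV : IsVine (block d 1 T) V) {s s' : ℤ} {m : ℕ} (hs' : 1 ≤ s') (ht' : s' + m ≤ T)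
    (hs : 1 ≤ s) (ht : s + m ≤ T) {k : ℕ} {e : Sym2 (Node (ℤ × Fin d) k)}
    (he : e ∈ (V.restrict (block d s (s + m))).edges k) :
    ∃ e' ∈ (V.restrict (block d s' (s' + m))).edges k, IsShift (s' - s) e' e := by
  obtain ⟨he1, hU⟩ := (hV.mem_restrict (block_subset hs ht) (k := k + 1)).1 he
  induction e using Sym2.ind with
  | _ x y =>
    obtain ⟨a, b, h⟩ := hV.exists_hasCondPair he1
    have hU' := hU
    rw [completeUnion_mk] at hU'
    have ha := hU' (.inl h.left_mem.1)
    have hb := hU' (.inr h.right_mem.1)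
    rw [Finset.mem_coe, mem_block] at ha hb
    obtain ⟨e', he', hsh⟩ := hcl k x y a b he1 h (s' - s)
      (by rw [mem_block, shift_fst]; omega) (by rw [mem_block, shift_fst]; omega)
    refine ⟨e', (hV.mem_restrict (block_subset hs' ht') (k := k + 1)).2 ⟨he', ?_⟩, hsh⟩
    rw [hsh.completeUnion_eq]
    rintro _ ⟨i, hi, rfl⟩
    have := hU hi
    rw [Finset.mem_coe, mem_block] at this ⊢
    rw [shift_fst]
    omega

theorem TranslationClosed.isTranslation (hcl : TranslationClosed T V)
    (hV : IsVine (block d 1 T) V) {m : ℕ} {t : ℤ} (ht1 : 1 ≤ t) (ht : t ≤ T - m) :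
    IsTranslation m t 1 (V.restrict (block d t (t + m))) (V.restrict (block d 1 (1 + m))) := by
  have hvine : ∀ s : ℤ, 1 ≤ s → s + m ≤ T → IsVine (block d s (s + m))
      (V.restrict (block d s (s + m))) := fun s hs hsT =>
    hV.restrict (block_subset hs hsT) fun k x y a b he h ha hb =>
      hcl.completeUnion_subset hV he h ha hb
  refine ⟨hvine t ht1 (by omega), hvine 1 le_rfl (by omega), fun k => ⟨fun e he => ?_,
    fun e he => ?_⟩⟩
  · obtain ⟨e', he', h⟩ := hcl.hasTranslate hV le_rfl (by omega) ht1 (by omega) he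
    refine ⟨e', he', ?_⟩
    have := h.symm
    rwa [neg_sub] at this
  · exact hcl.hasTranslate hV ht1 (by omega) le_rfl (by omega) he

end Closed

/-! ### Farlie-Gumbel-Morgenstern copulas on a shift class -/

section Copulas

/-- The centred uniform score `1 - 2 u`. -/
def score (u : ℝ) : ℝ := 1 - 2 * u

lemma continuous_score : Continuous score := by unfold score; fun_prop

lemma score_one_sub (u : ℝ) : score (1 - u) = -score u := by unfold score; ring

lemma score_abs_le {u : ℝ} (hu : u ∈ Set.Icc (0 : ℝ) 1) : |score u| ≤ 1 := by
  rw [abs_le, score]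
  constructor <;> linarith [hu.1, hu.2]

lemma one_add_score_mul_nonneg {u v : ℝ} (hu : u ∈ Set.Icc (0 : ℝ) 1)
    (hv : v ∈ Set.Icc (0 : ℝ) 1) : 0 ≤ 1 + score u * score v := by
  have h : |score u * score v| ≤ 1 := by
    rw [abs_mul]
    exact mul_le_one₀ (score_abs_le hu) (abs_nonneg _) (score_abs_le hv)
  linarith [neg_le_of_abs_le h]

lemma integral_one_add_score (c : ℝ) : ∫ u in (0 : ℝ)..1, (1 + score u * c) = 1 := by
  have h : ∀ u, HasDerivAt (fun u : ℝ => u + (u - u ^ 2) * c) (1 + score u * c) u := by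
    intro u
    have h1 := (hasDerivAt_id u).add (((hasDerivAt_id u).sub ((hasDerivAt_id u).pow 2)).mul_const c)
    exact h1.congr_deriv (by simp [score])
  rw [intervalIntegral.integral_eq_sub_of_hasDerivAt (fun u _ => h u)
    (Continuous.intervalIntegrable (by unfold score; fun_prop) _ _)]
  norm_num

/-- The Farlie-Gumbel-Morgenstern copula with density `1 + (1 - 2 u) (1 - 2 v)`. -/
def fgm : PairCopula where
  density u v := 1 + score u * score v
  measurable_density := by
    unfold score Function.uncurry
    fun_prop
  nonneg _ hu _ hv := one_add_score_mul_nonneg hu hv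
  integral_left v _ := integral_one_add_score (score v)
  integral_right u _ := by
    simp only [mul_comm (score u)]
    exact integral_one_add_score (score u)

/-- The independence copula. -/
def indep : PairCopula where
  density _ _ := 1
  measurable_density := measurable_const
  nonneg _ _ _ _ := zero_le_one
  integral_left _ _ := by simp
  integral_right _ _ := by simp

variable {d : ℕ}

open Classical in
/-- `fgm` on the shifts of `e₀`, independence elsewhere. -/
noncomputable def shiftCopulas {k₀ : ℕ} (e₀ : Sym2 (Node (ℤ × Fin d) k₀)) :
    PairCopulas (ℤ × Fin d) :=
  fun _ x y => if ∃ τ, IsShift τ s(x, y) e₀ then fgm else indep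

variable {k₀ : ℕ} {e₀ : Sym2 (Node (ℤ × Fin d) k₀)} {S : Finset (ℤ × Fin d)}
  {V : GraphSeq (ℤ × Fin d)}

lemma shiftCopulas_isChoiceFor : (shiftCopulas e₀).IsChoiceFor V := by
  intro k x y _ u v
  rw [shiftCopulas, shiftCopulas, Sym2.eq_swap]
  split_ifs
  · simp only [fgm, mul_comm]
  · rfl

lemma shiftCopulas_translationInvariant : TranslationInvariant V (shiftCopulas e₀) := by
  intro τ k l x y x' y' _ _ h
  have h1 : (∃ σ, IsShift σ s(x, y) e₀) ↔ ∃ σ, IsShift σ s(x', y') e₀ := by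
    constructor
    · rintro ⟨σ, hσ⟩
      exact ⟨_, IsShift.trans ⟨x', y', x, y, rfl, rfl, h.symm⟩ hσ⟩
    · rintro ⟨σ, hσ⟩
      exact ⟨_, IsShift.trans ⟨x, y, x', y', rfl, rfl, h⟩ hσ⟩
  unfold shiftCopulas
  by_cases h2 : ∃ σ, IsShift σ s(x, y) e₀
  · rw [if_pos h2, if_pos (h1.1 h2)]
  · rw [if_neg h2, if_neg fun h => h2 (h1.2 h)]

lemma IsVine.level_eq_of_isShift (hV : IsVine S V) (he₀ : e₀ ∈ V.edges k₀) {k : ℕ}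
    {e : Sym2 (Node (ℤ × Fin d) k)} (he : e ∈ V.edges k) {τ : ℤ} (h : IsShift τ e e₀) :
    k = k₀ := by
  have h1 := congrArg Set.ncard h.completeUnion_eq
  rw [Set.ncard_image_of_injective _ (shift_injective τ),
    hV.ncard_completeUnion (k := k + 1) he, hV.ncard_completeUnion (k := k₀ + 1) he₀] at h1
  omega

/-- Shifts preserve the size of the complete union, so all shifts of `e₀` are edges of level `k₀`.
Below it every copula is independence, and conditioning leaves the coordinate unchanged. -/
lemma IsVine.condValue_shiftCopulas (hV : IsVine S V) (he₀ : e₀ ∈ V.edges k₀)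
    (u : ℤ × Fin d → ℝ) : ∀ {k : ℕ} {v : Node (ℤ × Fin d) k} {a : ℤ × Fin d}, k ≤ k₀ →
      v ∈ V.verts k → IsCondElem k v a → condValue (shiftCopulas e₀) u k v a = u a
  | 0, v, a, _, _, ha => by rw [condValue, show v = a from ha]
  | k + 1, v, a, hk, hv, ha => by
    obtain ⟨x, y, b, rfl, h⟩ := ha
    have hno : ¬ ∃ τ, IsShift τ s(x, y) e₀ := by
      rintro ⟨τ, hτ⟩
      have := hV.level_eq_of_isShift he₀ hv hτ
      omega
    rw [condValue_mk h, hV.condValue_shiftCopulas he₀ u (by omega) (hV.left_mem hv)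
      (hV.isCondElem hv h), shiftCopulas, if_neg hno]
    simp [indep]

lemma IsVine.edgeFactor_shiftCopulas (hV : IsVine S V) (he₀ : e₀ ∈ V.edges k₀)
    (u : ℤ × Fin d → ℝ) {k : ℕ} {x y : Node (ℤ × Fin d) k} {a b : ℤ × Fin d}
    (he : s(x, y) ∈ V.edges k) (h : HasCondPair x y a b) {τ : ℤ} (hs : IsShift τ s(x, y) e₀) :
    edgeFactor (shiftCopulas e₀) u k s(x, y) = 1 + score (u a) * score (u b) := by
  have hk := hV.level_eq_of_isShift he₀ he hs
  have he' : s(y, x) ∈ V.edges k := by rw [Sym2.eq_swap]; exact he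
  rw [edgeFactor_mk shiftCopulas_isChoiceFor he h,
    hV.condValue_shiftCopulas he₀ u hk.le (hV.left_mem he) (hV.isCondElem he h),
    hV.condValue_shiftCopulas he₀ u hk.le (hV.right_mem he) (hV.isCondElem he' h.symm),
    shiftCopulas, if_pos ⟨τ, hs⟩]
  rfl

lemma IsVine.edgeFactor_shiftCopulas_of_not (hV : IsVine S V) (u : ℤ × Fin d → ℝ) {k : ℕ}
    {e : Sym2 (Node (ℤ × Fin d) k)} (he : e ∈ V.edges k) (hs : ¬ ∃ τ, IsShift τ e e₀) :
    edgeFactor (shiftCopulas e₀) u k e = 1 := by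
  induction e using Sym2.ind with
  | _ x y =>
    obtain ⟨a, b, h⟩ := hV.exists_hasCondPair he
    rw [edgeFactor_mk shiftCopulas_isChoiceFor he h, shiftCopulas, if_neg hs]
    rfl

/-- The product of the scores at the pair `(a, b)` shifted by `σ`. -/
def scorePair (a b : ℤ × Fin d) (σ : ℤ) (u : ℤ × Fin d → ℝ) : ℝ :=
  score (u (shift σ a)) * score (u (shift σ b))

lemma scorePair_comm (a b : ℤ × Fin d) (σ : ℤ) (u : ℤ × Fin d → ℝ) :
    scorePair a b σ u = scorePair b a σ u := mul_comm _ _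

lemma IsVine.shift_unique (hV : IsVine S V) {k : ℕ} {x y : Node (ℤ × Fin d) k₀}
    {a b : ℤ × Fin d} (h : HasCondPair x y a b) {e : Sym2 (Node (ℤ × Fin d) k)}
    (he : e ∈ V.edges k) {σ τ : ℤ} (h1 : IsShift σ e s(x, y)) (h2 : IsShift τ e s(x, y)) :
    σ = τ := by
  obtain ⟨p, q, hpq, h3⟩ := h1.exists_oriented
  obtain ⟨p', q', hpq', h4⟩ := h2.exists_oriented
  have hs1 := (h3.hasCondPair h).splits
  have hs2 := (h4.hasCondPair h).splits
  rw [← hpq] at hs1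
  rw [← hpq'] at hs2
  rcases hV.splits_unique (f := ⟨k, e⟩) he hs1 hs2 with ⟨h5, -⟩ | ⟨h5, h6⟩
  · have := congrArg Prod.fst h5
    simp only [shift_fst] at this
    omega
  -- If the two ends were interchanged, adding the two equations of times would still give `2 * σ =
  -- 2 * τ`.
  · have h7 := congrArg Prod.fst h5
    have h8 := congrArg Prod.fst h6
    simp only [shift_fst] at h7 h8
    omega

/-- Edges in the shift class are indexed by their shifts: an edge has only one, and two edges with
the same shift split the same pair. All other factors are one. -/
lemma IsVine.exists_vineDensity_shiftCopulas (hV : IsVine S V) {x y : Node (ℤ × Fin d) k₀}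
    {a b : ℤ × Fin d} (he₀ : s(x, y) ∈ V.edges k₀) (h : HasCondPair x y a b) :
    ∃ R : Finset ℤ, (∀ τ, τ ∈ R ↔ ∃ e' ∈ V.edges k₀, IsShift τ e' s(x, y)) ∧
      ∀ u, vineDensity S V (shiftCopulas s(x, y)) u = ∏ σ ∈ R, (1 + scorePair a b σ u) := by
  classical
  set P := hV.edgeFinset.filter fun f : Edge (ℤ × Fin d) => ∃ τ, IsShift τ f.2 s(x, y) with hP
  have hPe : ∀ f ∈ P, f.2 ∈ V.edges f.1 := fun f hf =>
    hV.mem_edgeFinset.1 (Finset.mem_filter.1 hf).1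
  have hex : ∀ f : Edge (ℤ × Fin d), ∃ τ, f ∈ P → IsShift τ f.2 s(x, y) := by
    intro f
    by_cases hf : f ∈ P
    · obtain ⟨τ, hτ⟩ := (Finset.mem_filter.1 hf).2
      exact ⟨τ, fun _ => hτ⟩
    · exact ⟨0, fun h => absurd h hf⟩
  choose σ hσ using hex
  refine ⟨P.image σ, fun τ => ?_, fun u => ?_⟩
  · rw [Finset.mem_image]
    constructor
    · rintro ⟨⟨k, e⟩, hf, rfl⟩
      have h1 := hσ _ hf
      obtain rfl := hV.level_eq_of_isShift he₀ (hPe _ hf) h1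
      exact ⟨e, hPe _ hf, h1⟩
    · rintro ⟨e', he', hs⟩
      have hf : (⟨k₀, e'⟩ : Edge (ℤ × Fin d)) ∈ P :=
        Finset.mem_filter.2 ⟨hV.mem_edgeFinset.2 he', τ, hs⟩
      exact ⟨_, hf, hV.shift_unique h (hPe _ hf) (hσ _ hf) hs⟩
  · rw [Finset.prod_image, hV.vineDensity_eq, ← Finset.prod_filter_mul_prod_filter_not _
      (fun f : Edge (ℤ × Fin d) => ∃ τ, IsShift τ f.2 s(x, y)), ← hP]
    · refine (congrArg₂ (· * ·) ?_ (Finset.prod_eq_one ?_)).trans (mul_one _)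
      · refine Finset.prod_congr rfl fun f hf => ?_
        obtain ⟨k, e⟩ := f
        obtain ⟨p, q, hpq, h1⟩ := IsShift.exists_oriented (k := k) (e := e) (hσ _ hf)
        obtain rfl : e = s(p, q) := hpq
        exact hV.edgeFactor_shiftCopulas he₀ u (hPe _ hf) (h1.hasCondPair h) (hσ _ hf)
      · intro f hf
        obtain ⟨hf1, hf2⟩ := Finset.mem_filter.1 hf
        exact hV.edgeFactor_shiftCopulas_of_not u (hV.mem_edgeFinset.1 hf1) hf2
    · intro f hf g hg hfg
      obtain ⟨p, q, hpq, h1⟩ := (hσ _ hf).exists_oriented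
      obtain ⟨p', q', hpq', h2⟩ := (hσ _ hg).exists_oriented
      have hs1 := (h1.hasCondPair h).splits
      have hs2 := (h2.hasCondPair h).splits
      rw [← hpq] at hs1
      rw [← hpq', ← hfg] at hs2
      exact hV.eq_of_splits (hPe _ hf) (hPe _ hg) hs1 hs2

end Copulas

/-! ### Moments of scores -/

section Moments

open Set

lemma continuous_extendZero {α : Type} {S : Finset α} (i : α) :
    Continuous fun z : S → ℝ => extendZero z i := by
  simp only [extendZero]
  split_ifs
  · exact continuous_apply _
  · exact continuous_const

variable {d : ℕ} {S : Finset (ℤ × Fin d)} {a b : ℤ × Fin d}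

lemma continuous_scorePair (σ : ℤ) :
    Continuous fun z : S → ℝ => scorePair a b σ (extendZero z) := by
  unfold scorePair
  exact (continuous_score.comp (continuous_extendZero _)).mul
    (continuous_score.comp (continuous_extendZero _))

lemma continuous_prod_scorePair (F : Finset ℤ) :
    Continuous fun z : S → ℝ => ∏ σ ∈ F, scorePair a b σ (extendZero z) :=
  continuous_finsetProd _ fun σ _ => continuous_scorePair σ

/-- The reflection of the coordinate `j`. -/
noncomputable def reflect (j : ℤ × Fin d) (z : S → ℝ) (i : S) : ℝ :=
  if (i : ℤ × Fin d) = j then 1 - z i else z i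

lemma measurePreserving_reflect (j : ℤ × Fin d) :
    MeasurePreserving (reflect (S := S) j) (volume.restrict (Icc 0 1))
      (volume.restrict (Icc 0 1)) := by
  have h1 : MeasurePreserving (fun t : ℝ => 1 - t) (volume.restrict (Icc 0 1))
      (volume.restrict (Icc 0 1)) := by
    have := (Measure.measurePreserving_sub_left (volume : Measure ℝ) 1).restrict_preimage
      (measurableSet_Icc (a := (0 : ℝ)) (b := 1))
    simpa using this
  rw [← pi_unif]
  refine measurePreserving_pi (fun i : S => unif (ℤ × Fin d) i) (fun i : S => unif (ℤ × Fin d) i)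
    (f := fun i t => if (i : ℤ × Fin d) = j then 1 - t else t) fun i => ?_
  by_cases hi : (i : ℤ × Fin d) = j
  · simp only [hi, if_true]
    exact h1
  · simp only [hi, if_false]
    exact MeasurePreserving.id _

lemma integral_eq_zero_of_reflect (j : ℤ × Fin d) {g : (S → ℝ) → ℝ} (hg : Continuous g)
    (h : ∀ z, g (reflect j z) = -g z) : ∫ z in Icc (0 : S → ℝ) 1, g z = 0 := by
  have h1 := (measurePreserving_reflect (S := S) j)
  have h2 : ∫ z in Icc (0 : S → ℝ) 1, g z = ∫ z in Icc (0 : S → ℝ) 1, g (reflect j z) := by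
    conv_lhs => rw [← h1.map_eq]
    exact integral_map h1.measurable.aemeasurable hg.aestronglyMeasurable
  simp only [h, integral_neg] at h2
  linarith

lemma score_reflect_self {j : ℤ × Fin d} (hj : j ∈ S) (z : S → ℝ) :
    score (extendZero (reflect j z) j) = -score (extendZero z j) := by
  rw [← score_one_sub]
  simp [extendZero, reflect, hj]

lemma score_reflect_of_ne {i j : ℤ × Fin d} (hij : i ≠ j) (z : S → ℝ) :
    score (extendZero (reflect j z) i) = score (extendZero z i) := by
  simp [extendZero, reflect, hij]

lemma score_reflect_sq {i j : ℤ × Fin d} (hj : j ∈ S) (z : S → ℝ) :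
    score (extendZero (reflect j z) i) ^ 2 = score (extendZero z i) ^ 2 := by
  by_cases hij : i = j
  · subst hij
    rw [score_reflect_self hj, neg_sq]
  · rw [score_reflect_of_ne hij]

/-- The latest copy of the later endpoint `b` occurs in exactly one factor, so reflecting it changes
the sign of the product. If `a` and `b` have equal times, their second coordinates keep them apart.
-/
lemma prod_scorePair_reflect (hab : a ≠ b) (hle : a.1 ≤ b.1) {F : Finset ℤ} (hF : F.Nonempty)
    (hS : shift (F.max' hF) b ∈ S) (z : S → ℝ) :
    ∏ σ ∈ F, scorePair a b σ (extendZero (reflect (shift (F.max' hF) b) z)) =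
      -∏ σ ∈ F, scorePair a b σ (extendZero z) := by
  set s := F.max' hF
  have hs : s ∈ F := F.max'_mem hF
  have ha : ∀ σ ∈ F, shift σ a ≠ shift s b := by
    intro σ hσ h
    have h1 := congrArg Prod.fst h
    have h2 : (shift σ a).2 = (shift s b).2 := by rw [h]
    have h3 : σ ≤ s := F.le_max' σ hσ
    simp only [shift_fst] at h1
    exact hab (Prod.ext (by omega) h2)
  rw [← Finset.mul_prod_erase F _ hs, ← Finset.mul_prod_erase F _ hs, ← neg_mul]
  congr 1
  · rw [scorePair, scorePair, score_reflect_self hS, score_reflect_of_ne (ha s hs), mul_neg]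
  · refine Finset.prod_congr rfl fun σ hσ => ?_
    obtain ⟨h1, h2⟩ := Finset.mem_erase.1 hσ
    rw [scorePair, scorePair, score_reflect_of_ne (ha σ h2), score_reflect_of_ne]
    intro h
    have := congrArg Prod.fst h
    simp only [shift_fst] at this
    omega

/-- A squared score is unchanged by reflections, so the extra factor does not spoil the change of
sign. Both `n = 0` and `n = 1` are needed later. -/
lemma integral_sq_mul_prod_scorePair (hab : a ≠ b) {F : Finset ℤ} (hF : F.Nonempty)
    (hS : ∀ σ ∈ F, shift σ a ∈ S ∧ shift σ b ∈ S) (τ : ℤ) (n : ℕ) :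
    ∫ z in Icc (0 : S → ℝ) 1, (scorePair a b τ (extendZero z) ^ 2) ^ n *
      ∏ σ ∈ F, scorePair a b σ (extendZero z) = 0 := by
  wlog hle : a.1 ≤ b.1 generalizing a b
  · simp only [scorePair_comm a b]
    exact this hab.symm (fun σ hσ => (hS σ hσ).symm) (by omega)
  have hj := (hS _ (F.max'_mem hF)).2
  refine integral_eq_zero_of_reflect (shift (F.max' hF) b)
    ((((continuous_scorePair τ).pow 2).pow n).mul (continuous_prod_scorePair F)) fun z => ?_
  rw [prod_scorePair_reflect hab hle hF hj, mul_neg]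
  congr 3
  rw [scorePair, scorePair, mul_pow, mul_pow, score_reflect_sq hj, score_reflect_sq hj]

lemma integral_prod_scorePair (hab : a ≠ b) {F : Finset ℤ} (hF : F.Nonempty)
    (hS : ∀ σ ∈ F, shift σ a ∈ S ∧ shift σ b ∈ S) :
    ∫ z in Icc (0 : S → ℝ) 1, ∏ σ ∈ F, scorePair a b σ (extendZero z) = 0 := by
  have := integral_sq_mul_prod_scorePair hab hF hS 0 0
  simpa using this

lemma integral_score_sq : ∫ t in Icc (0 : ℝ) 1, score t ^ 2 = 1 / 3 := by
  rw [integral_Icc_eq_integral_Ioc, ← intervalIntegral.integral_of_le zero_le_one]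
  have h : ∀ t, HasDerivAt (fun t : ℝ => t - 2 * t ^ 2 + 4 / 3 * t ^ 3) (score t ^ 2) t := by
    intro t
    have h1 := ((hasDerivAt_id t).sub (((hasDerivAt_id t).pow 2).const_mul 2)).add
      (((hasDerivAt_id t).pow 3).const_mul (4 / 3))
    exact h1.congr_deriv (by simp [score]; ring)
  rw [intervalIntegral.integral_eq_sub_of_hasDerivAt (fun t _ => h t)
    ((continuous_score.pow 2).intervalIntegrable _ _)]
  norm_num

/-- As `a ≠ b`, the integral factors over the coordinates, with `1 / 3` at `a` and at `b` and one
elsewhere. -/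
lemma integral_scorePair_sq_pos (hab : a ≠ b) (ha : a ∈ S) (hb : b ∈ S) :
    0 < ∫ z in Icc (0 : S → ℝ) 1, scorePair a b 0 (extendZero z) ^ 2 := by
  set f : S → ℝ → ℝ := fun i t =>
    (if i = ⟨a, ha⟩ then score t ^ 2 else 1) * (if i = ⟨b, hb⟩ then score t ^ 2 else 1) with hf
  have h1 : ∀ z : S → ℝ, scorePair a b 0 (extendZero z) ^ 2 = ∏ i, f i (z i) := by
    intro z
    simp only [hf, Finset.prod_mul_distrib, Finset.prod_ite_eq', Finset.mem_univ, if_true]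
    simp [scorePair, shift_zero, extendZero, ha, hb, mul_pow]
  simp only [h1]
  rw [← pi_unif, integral_fintype_prod_eq_prod]
  refine Finset.prod_pos fun i _ => ?_
  simp only [hf, unif]
  by_cases h2 : i = ⟨a, ha⟩
  · have h3 : i ≠ ⟨b, hb⟩ := by
      rw [h2]
      simpa using hab
    simp only [if_pos h2, if_neg h3, mul_one, integral_score_sq]
    norm_num
  · simp only [h2, if_false, one_mul]
    by_cases h3 : i = ⟨b, hb⟩
    · simp only [h3, if_true, integral_score_sq]
      norm_num
    · simp [h3]

/-- Expand the product over `R`. As `τ ∉ R`, every term is a product over distinct shifts, nonempty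
because `τ` occurs, and so has mean zero. -/
lemma integral_scorePair_mul_prod (hab : a ≠ b) {R : Finset ℤ}
    (hS : ∀ σ ∈ R, shift σ a ∈ S ∧ shift σ b ∈ S) {τ : ℤ} (hτ : τ ∉ R)
    (hτS : shift τ a ∈ S ∧ shift τ b ∈ S) :
    ∫ z in Icc (0 : S → ℝ) 1, scorePair a b τ (extendZero z) *
      ∏ σ ∈ R, (1 + scorePair a b σ (extendZero z)) = 0 := by
  simp only [Finset.prod_one_add, Finset.mul_sum]
  have hc : ∀ F : Finset ℤ, Continuous fun z : S → ℝ =>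
      scorePair a b τ (extendZero z) * ∏ σ ∈ F, scorePair a b σ (extendZero z) :=
    fun F => (continuous_scorePair τ).mul (continuous_prod_scorePair F)
  rw [integral_finsetSum _ fun F _ => (hc F).integrableOn_Icc]
  refine Finset.sum_eq_zero fun F hF => ?_
  have hF' := Finset.mem_powerset.1 hF
  have hins : ∀ z : S → ℝ, scorePair a b τ (extendZero z) *
      ∏ σ ∈ F, scorePair a b σ (extendZero z) =
      ∏ σ ∈ insert τ F, scorePair a b σ (extendZero z) := fun z =>
    (Finset.prod_insert (f := fun σ => scorePair a b σ (extendZero z))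
      fun h => hτ (hF' h)).symm
  simp only [hins]
  refine integral_prod_scorePair hab (Finset.insert_nonempty _ _) fun σ hσ => ?_
  rcases Finset.mem_insert.1 hσ with rfl | h
  · exact hτS
  · exact hS σ (hF' h)

/-- With `s` the score product at shift `0`, split `s * (1 + s) = s + s ^ 2`. The part with `s`
vanishes by the preceding lemma for `R.erase 0`; in the part with `s ^ 2` only the empty term of the
expansion survives. -/
lemma integral_scorePair_mul_prod_pos (hab : a ≠ b) {R : Finset ℤ}
    (hS : ∀ σ ∈ R, shift σ a ∈ S ∧ shift σ b ∈ S) (h0 : 0 ∈ R) :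
    0 < ∫ z in Icc (0 : S → ℝ) 1, scorePair a b 0 (extendZero z) *
      ∏ σ ∈ R, (1 + scorePair a b σ (extendZero z)) := by
  have h0S := hS 0 h0
  have hS' : ∀ σ ∈ R.erase 0, shift σ a ∈ S ∧ shift σ b ∈ S := fun σ hσ =>
    hS σ (Finset.mem_of_mem_erase hσ)
  have hc : ∀ F : Finset ℤ, Continuous fun z : S → ℝ =>
      (scorePair a b 0 (extendZero z) ^ 2) ^ 1 * ∏ σ ∈ F, scorePair a b σ (extendZero z) :=
    fun F => (((continuous_scorePair 0).pow 2).pow 1).mul (continuous_prod_scorePair F)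
  have hsplit : ∀ z : S → ℝ, scorePair a b 0 (extendZero z) *
      ∏ σ ∈ R, (1 + scorePair a b σ (extendZero z)) =
      scorePair a b 0 (extendZero z) *
        ∏ σ ∈ R.erase 0, (1 + scorePair a b σ (extendZero z)) +
      ∑ F ∈ (R.erase 0).powerset, (scorePair a b 0 (extendZero z) ^ 2) ^ 1 *
        ∏ σ ∈ F, scorePair a b σ (extendZero z) := by
    intro z
    rw [← Finset.mul_sum, ← Finset.prod_one_add, ← Finset.mul_prod_erase R _ h0]
    ring
  simp only [hsplit]
  rw [integral_add, integral_scorePair_mul_prod hab hS' (Finset.notMem_erase 0 R) h0S, zero_add,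
    integral_finsetSum _ fun F _ => (hc F).integrableOn_Icc,
    Finset.sum_eq_single ∅ ?_ fun h => absurd (Finset.empty_mem_powerset _) h]
  · simp only [Finset.prod_empty, mul_one, pow_one]
    rw [shift_zero, shift_zero] at h0S
    exact integral_scorePair_sq_pos hab h0S.1 h0S.2
  · intro F hF hne
    exact integral_sq_mul_prod_scorePair hab (Finset.nonempty_iff_ne_empty.2 hne)
      (fun σ hσ => hS' σ (Finset.mem_powerset.1 hF hσ)) 0 1
  · exact ((continuous_scorePair 0).mul (continuous_finsetProd _ fun σ _ =>
      continuous_const.add (continuous_scorePair σ))).integrableOn_Icc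
  · exact (continuous_finsetSum _ fun F _ => hc F).integrableOn_Icc

end Moments

/-! ### Stationary models force translation closedness -/

section Necessity

variable {T d : ℕ} {V : GraphSeq (ℤ × Fin d)}

lemma IsVine.integral_vineLaw {S : Finset (ℤ × Fin d)} (hV : IsVine S V)
    (C : PairCopulas (ℤ × Fin d)) (g : (S → ℝ) → ℝ) :
    ∫ z, g z ∂vineLaw S V C =
      ∫ z in Set.Icc (0 : S → ℝ) 1, g z * vineDensity S V C (extendZero z) := by
  have hm : Measurable fun z : S → ℝ => (vineDensity S V C (extendZero z)).toNNReal :=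
    ((hV.measurable_vineDensity C).comp measurable_extendZero).real_toNNReal
  refine (integral_withDensity_eq_integral_smul hm g).trans ?_
  refine setIntegral_congr_fun measurableSet_Icc fun z hz => ?_
  have h0 : 0 ≤ vineDensity S V C (extendZero z) := by
    rw [hV.vineDensity_eq]
    exact Finset.prod_nonneg fun f _ => edgeFactor_nonneg fun i _ => extendZero_mem hz i
  rw [NNReal.smul_def, Real.coe_toNNReal _ h0, smul_eq_mul, mul_comm]

lemma IsStationary.integral_scorePair_aux {P : Measure (block d 1 T → ℝ)}
    (h : IsStationary T d P) {a b : ℤ × Fin d} {τ : ℤ} (hτ : 1 ≤ τ) (ha : 1 ≤ a.1) (hb : 1 ≤ b.1)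
    (ha' : a.1 + τ ≤ T) (hb' : b.1 + τ ≤ T) :
    ∫ z, scorePair a b 0 (extendZero z) ∂P = ∫ z, scorePair a b τ (extendZero z) ∂P := by
  -- Stationarity is applied to all the times `1, …, T - τ` at once, since the times of `a` and `b`
  -- may coincide or come in either order.
  obtain ⟨m, hm⟩ : ∃ m : ℕ, (m : ℤ) = T - τ := ⟨(T - τ).toNat, Int.toNat_of_nonneg (by omega)⟩
  have h1 := h m (fun i => (i : ℤ) + 1) τ (fun i j hij => by
    have : (i : ℕ) < j := hij
    dsimp only
    omega) (fun i => by omega) hτ (fun i => by have := i.2; omega)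
  obtain ⟨p, hp⟩ : ∃ p : Fin m, ((p : ℕ) : ℤ) + 1 = a.1 :=
    ⟨⟨(a.1 - 1).toNat, by omega⟩, by dsimp only; omega⟩
  obtain ⟨q, hq⟩ : ∃ q : Fin m, ((q : ℕ) : ℤ) + 1 = b.1 :=
    ⟨⟨(b.1 - 1).toNat, by omega⟩, by dsimp only; omega⟩
  have hmeas : ∀ t : Fin m → ℤ, Measurable fun (u : block d 1 T → ℝ) (i : Fin m) (j : Fin d) =>
      extendZero u (t i, j) := fun t => measurable_pi_lambda _ fun i =>
    measurable_pi_lambda _ fun j =>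
      (measurable_pi_apply (t i, j)).comp (measurable_extendZero (S := block d 1 T))
  have hg : Continuous fun w : Fin m → Fin d → ℝ => score (w p a.2) * score (w q b.2) := by
    unfold score
    fun_prop
  have h2 := congrArg (fun Q => ∫ w, score (w p a.2) * score (w q b.2) ∂Q) h1
  rw [integral_map (hmeas fun i => (i : ℤ) + 1).aemeasurable hg.aestronglyMeasurable,
    integral_map (hmeas fun i => (i : ℤ) + 1 + τ).aemeasurable hg.aestronglyMeasurable] at h2
  simp only [hp, hq] at h2
  simp only [scorePair, shift_zero]
  exact h2

lemma IsStationary.integral_scorePair {P : Measure (block d 1 T → ℝ)}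
    (h : IsStationary T d P) {a b : ℤ × Fin d} {τ : ℤ} (ha : a ∈ block d 1 T)
    (hb : b ∈ block d 1 T) (ha' : shift τ a ∈ block d 1 T) (hb' : shift τ b ∈ block d 1 T) :
    ∫ z, scorePair a b 0 (extendZero z) ∂P = ∫ z, scorePair a b τ (extendZero z) ∂P := by
  rw [mem_block] at ha hb ha' hb'
  rw [shift_fst] at ha' hb'
  rcases lt_trichotomy τ 0 with hτ | rfl | hτ
  · have := h.integral_scorePair_aux (a := shift τ a) (b := shift τ b) (τ := -τ) (by omega)
      ha'.1 hb'.1 (by rw [shift_fst]; omega) (by rw [shift_fst]; omega)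
    simp only [scorePair, shift_shift, neg_add_cancel, zero_add] at this ⊢
    exact this.symm
  · rfl
  · exact h.integral_scorePair_aux (by omega) ha.1 hb.1 ha'.2 hb'.2

/-- If all translation invariant models on `V` are stationary, then `V` is translation closed. -/
theorem translationClosed_of_isStationary (hV : IsVine (block d 1 T) V)
    (h : ∀ C : PairCopulas (ℤ × Fin d), C.IsChoiceFor V → TranslationInvariant V C →
      IsStationary T d (vineLaw (block d 1 T) V C)) : TranslationClosed T V := by
  intro k x y a b he hab τ ha hb
  by_contra hne
  obtain ⟨R, hR, hdens⟩ := hV.exists_vineDensity_shiftCopulas he hab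
  have ha0 := hV.completeUnion_subset (hV.left_mem he) hab.left_mem.1
  have hb0 := hV.completeUnion_subset (hV.right_mem he) hab.right_mem.1
  have hst := (h _ (shiftCopulas_isChoiceFor (e₀ := s(x, y)))
    shiftCopulas_translationInvariant).integral_scorePair ha0 hb0 ha hb
  rw [hV.integral_vineLaw, hV.integral_vineLaw] at hst
  simp only [hdens] at hst
  have hRS : ∀ σ ∈ R, shift σ a ∈ block d 1 T ∧ shift σ b ∈ block d 1 T := by
    intro σ hσ
    obtain ⟨e', he', hs⟩ := (hR σ).1 hσ
    have hsub := hV.completeUnion_subset (k := k + 1) he'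
    rw [hs.completeUnion_eq, completeUnion_mk] at hsub
    exact ⟨hsub ⟨a, .inl hab.left_mem.1, rfl⟩, hsub ⟨b, .inr hab.right_mem.1, rfl⟩⟩
  have h0 : 0 ∈ R := (hR 0).2 ⟨s(x, y), he, x, y, x, y, rfl, rfl,
    (image_shift_zero _).symm, (image_shift_zero _).symm, (image_shift_zero _).symm⟩
  -- The moment at shift `0` is positive, the one at `τ ∉ R` is zero, and `hst` equates them.
  have hpos := integral_scorePair_mul_prod_pos hab.ne hRS h0
  rw [hst, integral_scorePair_mul_prod hab.ne hRS (fun hτ => hne ((hR τ).1 hτ)) ⟨ha, hb⟩] at hpos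
  exact lt_irrefl _ hpos

end Necessity

end SVine

/-- Characterisation of stationary vines. -/
theorem mainTheorem1 (T d : ℕ) (hT : 1 ≤ T) (hd : 1 ≤ d) (V : SVine.GraphSeq (ℤ × Fin d))
    (hV : SVine.IsVine (SVine.block d 1 T) V) :
    (∀ C : SVine.PairCopulas (ℤ × Fin d), C.IsChoiceFor V → SVine.TranslationInvariant V C →
        SVine.IsStationary T d (SVine.vineLaw (SVine.block d 1 T) V C)) ↔
      ∃ W : ℕ → SVine.GraphSeq (ℤ × Fin d), ∀ m : ℕ, m < T →
        SVine.IsVine (SVine.block d 1 (1 + m)) (W m) ∧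
          ∀ t : ℤ, 1 ≤ t → t ≤ T - m →
            SVine.IsTranslation m t 1 (V.restrict (SVine.block d t (t + m))) (W m) := by
  constructor
  · intro h
    have hcl := SVine.translationClosed_of_isStationary hV h
    refine ⟨fun m => V.restrict (SVine.block d 1 (1 + m)), fun m hm =>
      ⟨(hcl.isTranslation hV le_rfl (by omega)).1, fun t ht1 ht => hcl.isTranslation hV ht1 ht⟩⟩
  · rintro ⟨W, hW⟩ C hc hC
    exact SVine.isStationary_of_isTranslation hd hV (fun m hm => (hW m hm).2) hc hC
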